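/- Let $\ell, L>0$ and put $Q_1=[0,\ell]\times[0,1]$, $Q_2=[0,L]\times[0,1]$, regarded as subsets of $\mathbb C$ with $z=x+iy$. Let $p>1$ and let $\lambda:[0,\ell]\to(0,\infty)$ be a piecewise continuous weight (continuous off a finite set) that is bounded and bounded away from $0$. Let $\mathcal F$ be the family of all homeomorphisms $f$ of $Q_1$ onto $Q_2$ that have finite distortion, that is, $f\in W^{1,1}_{loc}$ in the interior of $Q_1$, the Jacobian determinant $J(z,f)$ is nonnegative almost everywhere, and there is an almost everywhere finite function $K$ with $|f_x|^2+|f_y|^2\leq K(z)\,J(z,f)$ almost everywhere; and that satisfy the boundary conditions $$\mathrm{Re}\, f(iy)=0,\quad \mathrm{Re}\, f(\ell+iy)=L\quad(0\le y\le 1),\qquad \mathrm{Im}\, f(x)=0,\quad \mathrm{Im}\, f(x+i)=1\quad(0\le x\le \ell).$$ For $f\in\mathcal F$ let $$\mathbb K(z,f)=\frac{|f_z|^2+|f_{\bar z}|^2}{|f_z|^2-|f_{\bar z}|^2}=\frac{|f_x|^2+|f_y|^2}{2J(z,f)}$$ where $J(z,f)>0$, and $\mathbb K(z,f)=1$ elsewhere.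 Then the minimisation problem $$\min_{f\in\mathcal F}\int_{Q_1}\mathbb K(z,f)^p\,\lambda(x)\,|dz|^2$$ has a solution in $\mathcal F$, its minimal value is finite, the solution is unique in $\mathcal F$, and it has the form $f(z)=u(x)+iy$. In particular a minimiser exists for all $\ell,L>0$ (there is no Nitsche phenomenon when $p>1$). -/

import Mathlib

open MeasureTheory Set Complex
open scoped ContDiff

namespace Grotzsch

/-- The closed rectangle `[0, a] × [0, 1]` in the complex plane. -/
def rect (a : ℝ) : Set ℂ := Icc 0 a ×ℂ Icc 0 1

/-- The open rectangle `(0, a) × (0, 1)` in the complex plane. -/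
def openRect (a : ℝ) : Set ℂ := Ioo 0 a ×ℂ Ioo 0 1

/-- `g` is a weak (distributional) derivative of `f` in the direction `v` on the open set `Ω`,
both functions being locally integrable on `Ω`. -/
structure HasWeakDeriv (Ω : Set ℂ) (v : ℂ) (f g : ℂ → ℂ) : Prop where
  locallyIntegrable : LocallyIntegrableOn f Ω volume
  locallyIntegrable_deriv : LocallyIntegrableOn g Ω volume
  integral_eq : ∀ φ : ℂ → ℝ, ContDiff ℝ ∞ φ → HasCompactSupport φ → tsupport φ ⊆ Ω →
    ∫ z, φ z • g z = - ∫ z, (fderiv ℝ φ z v) • f z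

/-- `f` belongs to the Sobolev class `W^{1,1}_loc(Ω)`. -/
def MemSobolevLoc (Ω : Set ℂ) (f : ℂ → ℂ) : Prop :=
  (∃ g, HasWeakDeriv Ω 1 f g) ∧ ∃ g, HasWeakDeriv Ω I f g

open Classical in
/-- The weak derivative of `f` on `Ω` in the direction `v` (unique almost everywhere in `Ω`);
it is `0` if there is none. -/
noncomputable def weakDeriv (Ω : Set ℂ) (v : ℂ) (f : ℂ → ℂ) : ℂ → ℂ :=
  if h : ∃ g, HasWeakDeriv Ω v f g then h.choose else 0

/-- The Jacobian determinant `J(z, f) = Im (conj f_x * f_y)`. -/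
noncomputable def jacobian (Ω : Set ℂ) (f : ℂ → ℂ) (z : ℂ) : ℝ :=
  (weakDeriv Ω 1 f z).re * (weakDeriv Ω I f z).im - (weakDeriv Ω 1 f z).im * (weakDeriv Ω I f z).re

/-- The squared Hilbert-Schmidt norm `|Df(z)|² = |f_x|² + |f_y|²`. -/
noncomputable def normSqDeriv (Ω : Set ℂ) (f : ℂ → ℂ) (z : ℂ) : ℝ :=
  ‖weakDeriv Ω 1 f z‖ ^ 2 + ‖weakDeriv Ω I f z‖ ^ 2

/-- The Sobolev part of the definition of a homeomorphism of finite distortion: `f` is in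
`W^{1,1}_loc(Ω)`, its Jacobian is nonnegative, and `|Df|² ≤ K J` for a finite function `K`, almost
everywhere in `Ω`. -/
structure FiniteDistortion (Ω : Set ℂ) (f : ℂ → ℂ) : Prop where
  memSobolevLoc : MemSobolevLoc Ω f
  jacobian_nonneg : ∀ᵐ z ∂volume.restrict Ω, 0 ≤ jacobian Ω f z
  exists_bound : ∃ K : ℂ → ℝ, ∀ᵐ z ∂volume.restrict Ω,
    normSqDeriv Ω f z ≤ K z * jacobian Ω f z

/-- The distortion `(|f_z|² + |f_z̄|²) / (|f_z|² - |f_z̄|²) = (|f_x|² + |f_y|²) / (2 J)`, with the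
usual value `1` where the Jacobian vanishes (almost everywhere there `Df = 0`, for a mapping of
finite distortion). -/
noncomputable def distortion (Ω : Set ℂ) (f : ℂ → ℂ) (z : ℂ) : ℝ :=
  if 0 < jacobian Ω f z then normSqDeriv Ω f z / (2 * jacobian Ω f z) else 1

/-- The family of homeomorphisms of finite distortion of `[0, l] × [0, 1]` onto
`[0, L] × [0, 1]` that satisfy the Grötzsch boundary conditions. A continuous bijection between
these compact sets is a homeomorphism. -/
structure Admissible (l L : ℝ) (f : ℂ → ℂ) : Prop where
  continuousOn : ContinuousOn f (rect l)
  bijOn : BijOn f (rect l) (rect L)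
  finiteDistortion : FiniteDistortion (openRect l) f
  left : ∀ y ∈ Icc (0 : ℝ) 1, (f (y * I)).re = 0
  right : ∀ y ∈ Icc (0 : ℝ) 1, (f (l + y * I)).re = L
  bottom : ∀ x ∈ Icc (0 : ℝ) l, (f x).im = 0
  top : ∀ x ∈ Icc (0 : ℝ) l, (f (x + I)).im = 1

/-- The weighted functional `∫ K(z, f)^p λ(x) |dz|²` over `[0, l] × [0, 1]`, with values in
`[0, ∞]`. -/
noncomputable def energy (l p : ℝ) (lam : ℝ → ℝ) (f : ℂ → ℂ) : ENNReal :=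
  ∫⁻ z in rect l, ENNReal.ofReal (distortion (openRect l) f z ^ p * lam z.re)

/-- `f` is a solution of the minimisation problem: it is admissible and has least energy among
admissible mappings. -/
def IsMinimiser (l L p : ℝ) (lam : ℝ → ℝ) (f : ℂ → ℂ) : Prop :=
  Admissible l L f ∧ ∀ g, Admissible l L g → energy l p lam f ≤ energy l p lam g

/-- `lam` is continuous on `[0, l]` off a finite set. -/
def PiecewiseContinuous (l : ℝ) (lam : ℝ → ℝ) : Prop :=
  ∃ S : Set ℝ, S.Finite ∧ ContinuousOn lam (Icc 0 l \ S)

end Grotzsch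

/-! The minimiser is found from its Euler–Lagrange equation, and minimality is proved by
calibration. Let D(t) = ((t + 1/t)/2)^p, which is the p-th power of the distortion of x + iy ↦ tx +
iy. It is strictly convex and invariant under t ↦ 1/t. For p > 1 its derivative maps (0,∞) onto ℝ,
so λ(x) D'(a(x)) = α is solvable for every real α. The constant α is then fixed by ∫ a = L
(`exists_stretch`). The candidate is u(x) + iy with u' = a. When p = 1 the derivative D' is bounded
above, which is where the Nitsche phenomenon enters.

Let g be a competitor with Jacobian J. From J ≤ |g_x||g_y| follow K^p ≥ D(|g_x|²/J) and K^p ≥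
D(|g_y|²/J). If α ≥ 0, the tangent line of D at a gives λK^p ≥ λD(a) + α(|g_x|²/J - a), and a square
gives |g_x|²/J ≥ 2 Re g_x - J. The boundary conditions give ∫ Re g_x = L, and injectivity gives ∫ J
≤ L, so the integral of 2 Re g_x - J - a is nonnegative. The area bound is one-sided, hence the sign
condition on α. If α ≤ 0, the tangent at 1/a is used with g_y, together with a²|g_y|²/J ≥ 2a Im g_y
- J and ∫ a Im g_y = ∫ a = L. These are `pointwise_horizontal`, `pointwise_vertical` and
`integral_le_of_calibration`. Equality forces g_x = a and g_y = i almost everywhere, and the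
boundary conditions then determine g (`Admissible.eqOn_of_ae_weakDeriv_eq`).

Two analytic facts are needed for merely W^{1,1}_loc homeomorphisms. The first is the area
inequality `lintegral_jacobian_le`: up to a null set the domain is a countable union of measurable
sets on which the map is differentiable relative to the set, and the change of variables formula
applies on each. The second is `integral_weighted`, which recovers boundary values from a weak
derivative by testing against cutoffs that exhaust the rectangle. -/

namespace Grotzsch

open Filter Topology
open scoped Convolution

/-! ### Mollification controlled by the mean oscillation of the weak derivatives -/

/-- The real-linear map of `ℂ` with partial derivatives `p` and `q`. -/
noncomputable def lin (p q : ℂ) : ℂ →L[ℝ] ℂ := reCLM.smulRight p + imCLM.smulRight q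

theorem lin_apply (p q v : ℂ) : lin p q v = v.re • p + v.im • q := by
  simp [lin]

theorem lin_sub (p q p' q' : ℂ) : lin p q - lin p' q' = lin (p - p') (q - q') := by
  ext v
  simp [lin_apply, smul_sub]
  ring

theorem norm_lin_le (p q : ℂ) : ‖lin p q‖ ≤ ‖p‖ + ‖q‖ := by
  refine ContinuousLinearMap.opNorm_le_bound _ (by positivity) fun v => ?_
  rw [lin_apply]
  calc ‖v.re • p + v.im • q‖ ≤ ‖v.re • p‖ + ‖v.im • q‖ := norm_add_le _ _
    _ = |v.re| * ‖p‖ + |v.im| * ‖q‖ := by rw [norm_smul, norm_smul]; simp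
    _ ≤ ‖v‖ * ‖p‖ + ‖v‖ * ‖q‖ := by
      gcongr
      · exact abs_re_le_norm v
      · exact abs_im_le_norm v
    _ = (‖p‖ + ‖q‖) * ‖v‖ := by ring

theorem det_lin (p q : ℂ) : (lin p q).det = p.re * q.im - p.im * q.re := by
  rw [ContinuousLinearMap.det, ← LinearMap.det_toMatrix Complex.basisOneI, Matrix.det_fin_two]
  simp [LinearMap.toMatrix_apply, lin_apply]
  ring

/-- The dyadic scale `2⁻ᵏ`. -/
noncomputable def scale (k : ℕ) : ℝ := (1 / 2) ^ k

theorem scale_pos (k : ℕ) : 0 < scale k := by unfold scale; positivity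

theorem scale_succ (k : ℕ) : scale (k + 1) = scale k / 2 := by unfold scale; ring

/-- A smooth bump function supported in the disc of radius `2⁻ᵏ`. -/
noncomputable def bump (k : ℕ) : ContDiffBump (0 : ℂ) :=
  ⟨scale k / 2, scale k, by have := scale_pos k; positivity, by have := scale_pos k; linarith⟩

/-- The mollifier of scale `2⁻ᵏ`. -/
noncomputable def ker (k : ℕ) : ℂ → ℝ := (bump k).normed volume

theorem ker_nonneg (k : ℕ) (x : ℂ) : 0 ≤ ker k x := (bump k).nonneg_normed x

theorem integral_ker (k : ℕ) : ∫ x, ker k x = 1 := (bump k).integral_normed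

theorem contDiff_ker (k : ℕ) : ContDiff ℝ ∞ (ker k) := (bump k).contDiff_normed

theorem hasCompactSupport_ker (k : ℕ) : HasCompactSupport (ker k) :=
  (bump k).hasCompactSupport_normed

theorem tsupport_ker (k : ℕ) : tsupport (ker k) = Metric.closedBall 0 (scale k) :=
  (bump k).tsupport_normed_eq

theorem ker_eq_zero {k : ℕ} {x : ℂ} (h : scale k < ‖x‖) : ker k x = 0 := by
  apply image_eq_zero_of_notMem_tsupport
  rw [tsupport_ker]
  simpa using h

theorem ker_neg (k : ℕ) (x : ℂ) : ker k (-x) = ker k x := (bump k).normed_neg x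

theorem ker_le (k : ℕ) (x : ℂ) : ker k x ≤ 2 / scale k ^ 2 := by
  have h := (bump k).normed_le_div_measure_closedBall_rIn volume x
  have h2 : volume.real (Metric.closedBall (0 : ℂ) (bump k).rIn) = (scale k / 2) ^ 2 * Real.pi := by
    rw [Measure.real, Complex.volume_closedBall]
    have := scale_pos k
    simp [bump, ENNReal.toReal_mul, ENNReal.toReal_ofReal, (half_pos this).le]
  refine h.trans ?_
  rw [h2]
  have := scale_pos k
  have hp := Real.pi_gt_three
  rw [div_le_div_iff₀ (by positivity) (by positivity)]
  nlinarith [sq_nonneg (scale k), sq_pos_of_pos this]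

/-- Mollification at scale `2⁻ᵏ`. -/
noncomputable def moll (k : ℕ) (F : ℂ → ℂ) : ℂ → ℂ :=
  ker k ⋆[ContinuousLinearMap.lsmul ℝ ℝ, volume] F

theorem moll_apply (k : ℕ) (F : ℂ → ℂ) (z : ℂ) : moll k F z = ∫ t, ker k (z - t) • F t :=
  convolution_lsmul_swap

theorem continuous_ker (k : ℕ) : Continuous (ker k) := (contDiff_ker k).continuous

theorem integrable_ker_smul (k : ℕ) {F : ℂ → ℂ} (hF : LocallyIntegrable F) (z : ℂ) :
    Integrable fun t => ker k (z - t) • F t := by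
  apply hF.integrable_smul_left_of_hasCompactSupport
  · exact (continuous_ker k).comp (by fun_prop)
  · exact (hasCompactSupport_ker k).comp_homeomorph (Homeomorph.subLeft z)

theorem integral_ker_sub (k : ℕ) (z : ℂ) : ∫ t, ker k (z - t) = 1 := by
  rw [integral_sub_left_eq_self (ker k) volume z, integral_ker]

theorem integrable_ker_sub (k : ℕ) (z : ℂ) : Integrable fun t => ker k (z - t) := by
  apply Continuous.integrable_of_hasCompactSupport
  · exact (continuous_ker k).comp (by fun_prop)
  · exact (hasCompactSupport_ker k).comp_homeomorph (Homeomorph.subLeft z)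

theorem continuous_moll (k : ℕ) {F : ℂ → ℂ} (hF : LocallyIntegrable F) : Continuous (moll k F) :=
  (hasCompactSupport_ker k).continuous_convolution_left _ (continuous_ker k) hF

/-- The scaled mean oscillation about the value at `z`. -/
noncomputable def osc (k : ℕ) (P : ℂ → ℂ) (z : ℂ) : ℝ :=
  (∫ w in Metric.closedBall z (2 * scale k), ‖P w - P z‖) / scale k ^ 2

theorem osc_nonneg (k : ℕ) (P : ℂ → ℂ) (z : ℂ) : 0 ≤ osc k P z := by
  unfold osc; positivity

/-- The mollifier at ζ is an average over a disc inside the disc of radius `2 * scale k` about z.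
Two consecutive scales are treated at once because they are compared with each other later. -/
theorem norm_moll_sub_le {k j : ℕ} (hj : j = k ∨ j = k + 1) {P : ℂ → ℂ}
    (hP : LocallyIntegrable P) {z ζ : ℂ} (hζ : ‖ζ - z‖ ≤ scale k) :
    ‖moll j P ζ - P z‖ ≤ 8 * osc k P z := by
  have hk := scale_pos k
  -- The bound `2 / scale j ^ 2` becomes `8 / scale k ^ 2` in the worse case j = k + 1.
  have hker : ∀ x, ker j x ≤ 8 / scale k ^ 2 := by
    intro x
    refine (ker_le j x).trans ?_
    rcases hj with rfl | rfl
    · gcongr; norm_num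
    · rw [scale_succ]; apply le_of_eq; field_simp; norm_num
  have hs : scale j ≤ scale k := by
    rcases hj with rfl | rfl
    · rfl
    · rw [scale_succ]; linarith
  have h1 : moll j P ζ - P z = ∫ t, ker j (ζ - t) • (P t - P z) := by
    simp_rw [smul_sub]
    rw [integral_sub (integrable_ker_smul j hP ζ) ((integrable_ker_sub j ζ).smul_const _),
      integral_smul_const, integral_ker_sub, one_smul, moll_apply]
  have h2 : ∫ t, ker j (ζ - t) • (P t - P z)
      = ∫ t in Metric.closedBall z (2 * scale k), ker j (ζ - t) • (P t - P z) := by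
    symm
    apply setIntegral_eq_integral_of_forall_compl_eq_zero
    intro t ht
    rw [ker_eq_zero, zero_smul]
    rw [Metric.mem_closedBall, not_le, dist_eq_norm] at ht
    have : ‖t - z‖ ≤ ‖ζ - t‖ + ‖ζ - z‖ := by
      have := norm_sub_le (ζ - z) (ζ - t)
      rw [show ζ - z - (ζ - t) = t - z by ring] at this
      linarith
    linarith
  have hint : IntegrableOn (fun t => ‖P t - P z‖) (Metric.closedBall z (2 * scale k)) := by
    apply Integrable.norm
    apply Integrable.sub
    · exact hP.integrableOn_isCompact (isCompact_closedBall _ _)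
    · exact continuousOn_const.integrableOn_compact (isCompact_closedBall _ _)
  rw [h1, h2]
  calc _ ≤ ∫ t in Metric.closedBall z (2 * scale k), ‖ker j (ζ - t) • (P t - P z)‖ :=
        norm_integral_le_integral_norm _
    _ ≤ ∫ t in Metric.closedBall z (2 * scale k), 8 / scale k ^ 2 * ‖P t - P z‖ := by
        apply integral_mono_of_nonneg
        · exact Eventually.of_forall fun t => norm_nonneg _
        · exact hint.const_mul _
        · refine Eventually.of_forall fun t => ?_
          simp only [norm_smul, Real.norm_eq_abs, abs_of_nonneg (ker_nonneg _ _)]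
          gcongr
          exact hker _
    _ = _ := by rw [integral_const_mul, osc]; ring

/-- The derivative falls on the kernel, and t ↦ `ker k (z - t)` is an admissible test function
because its support lies in U. -/
theorem hasFDerivAt_moll {U : Set ℂ} {F P Q : ℂ → ℂ} (hF : LocallyIntegrable F)
    (h1 : HasWeakDeriv U 1 F P) (hI : HasWeakDeriv U I F Q) {k : ℕ} {z : ℂ}
    (hz : Metric.closedBall z (scale k) ⊆ U) :
    HasFDerivAt (moll k F) (lin (moll k P z) (moll k Q z)) z := by
  have key : ∀ (v : ℂ) (G : ℂ → ℂ), HasWeakDeriv U v F G →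
      ∫ t, (fderiv ℝ (ker k) (z - t) v) • F t = moll k G z := by
    intro v G hG
    have hφ : ContDiff ℝ ∞ fun t => ker k (z - t) := (contDiff_ker k).comp (by fun_prop)
    have h := hG.integral_eq (fun t => ker k (z - t)) hφ
      ((hasCompactSupport_ker k).comp_homeomorph (Homeomorph.subLeft z)) (by
        refine subset_trans (closure_minimal ?_ Metric.isClosed_closedBall) hz
        intro t ht
        by_contra hc
        apply ht
        apply ker_eq_zero
        rw [Metric.mem_closedBall, not_le, dist_eq_norm, norm_sub_rev] at hc
        exact hc)
    rw [moll_apply, h, ← integral_neg]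
    congr 1
    ext1 t
    have hd : HasFDerivAt (fun t => ker k (z - t))
        ((fderiv ℝ (ker k) (z - t)).comp (-ContinuousLinearMap.id ℝ ℂ)) t := by
      have h1 : HasFDerivAt (ker k) (fderiv ℝ (ker k) (z - t)) (z - t) :=
        ((contDiff_ker k).differentiable (by simp) _).hasFDerivAt
      exact h1.comp t ((hasFDerivAt_id t).const_sub z)
    rw [hd.fderiv]
    simp
  have hd := (hasCompactSupport_ker k).hasFDerivAt_convolution_left
    (ContinuousLinearMap.lsmul ℝ ℝ : ℝ →L[ℝ] ℂ →L[ℝ] ℂ) ((contDiff_ker k).of_le (by simp)) hF z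
  suffices h : lin (moll k P z) (moll k Q z) = convolution (fderiv ℝ (ker k)) F
      ((ContinuousLinearMap.lsmul ℝ ℝ : ℝ →L[ℝ] ℂ →L[ℝ] ℂ).precompL ℂ) volume z by
    rw [h]; exact hd
  ext1 v
  have hcs : HasCompactSupport (fderiv ℝ (ker k)) := (hasCompactSupport_ker k).fderiv ℝ
  have hcf : Continuous (fderiv ℝ (ker k)) := (contDiff_ker k).continuous_fderiv (by simp)
  have hex := (hcs.convolutionExists_left
    ((ContinuousLinearMap.lsmul ℝ ℝ : ℝ →L[ℝ] ℂ →L[ℝ] ℂ).precompL ℂ) hcf hF) z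
  have happ : ∀ v : ℂ, (convolution (fderiv ℝ (ker k)) F
      ((ContinuousLinearMap.lsmul ℝ ℝ : ℝ →L[ℝ] ℂ →L[ℝ] ℂ).precompL ℂ) volume z) v
      = ∫ t, (fderiv ℝ (ker k) (z - t) v) • F t := by
    intro v
    rw [convolution_eq_swap, ContinuousLinearMap.integral_apply]
    · simp [ContinuousLinearMap.precompL_apply]
    · exact (hex.integrable_swap)
  have hv : v = v.re • (1 : ℂ) + v.im • I := by
    apply Complex.ext <;> simp
  rw [lin_apply]
  conv_rhs => rw [hv]
  rw [map_add, map_smul, map_smul, happ, happ, key 1 P h1, key I Q hI]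

section

/-- Commutation allows the mollifications at two scales to be compared through their common double
mollification, with no Poincaré inequality. -/
theorem moll_moll_comm (j k : ℕ) {F : ℂ → ℂ} (hF : LocallyIntegrable F) :
    moll j (moll k F) = moll k (moll j F) := by
  have assoc : ∀ i m : ℕ, moll i (moll m F)
      = convolution (convolution (ker i) (ker m) (ContinuousLinearMap.lsmul ℝ ℝ) volume) F
        (ContinuousLinearMap.lsmul ℝ ℝ) volume := by
    intro i m
    ext1 x
    symm
    have hn : ∀ m, HasCompactSupport fun x => ‖ker m x‖ := fun m => (hasCompactSupport_ker m).norm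
    have hc : ∀ m, Continuous fun x => ‖ker m x‖ := fun m => (continuous_ker m).norm
    have hF' : LocallyIntegrable fun x => ‖F x‖ := fun x =>
      let ⟨s, hs, h⟩ := hF x
      ⟨s, hs, h.norm⟩
    refine convolution_assoc (L := ContinuousLinearMap.lsmul ℝ ℝ)
      (L₂ := ContinuousLinearMap.lsmul ℝ ℝ) (L₃ := ContinuousLinearMap.lsmul ℝ ℝ)
      (L₄ := ContinuousLinearMap.lsmul ℝ ℝ) ?_ ?_ ?_ ?_ ?_ ?_ ?_
    · intro a b c
      simp [mul_assoc]
    · exact (continuous_ker i).aestronglyMeasurable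
    · exact (continuous_ker m).aestronglyMeasurable
    · exact hF.aestronglyMeasurable
    · exact Eventually.of_forall fun y => (hasCompactSupport_ker i).convolutionExists_left _
        (continuous_ker i) (continuous_ker m).locallyIntegrable y
    · exact Eventually.of_forall fun y => (hn m).convolutionExists_left _ (hc m) hF' y
    · exact (hn i).convolutionExists_left _ (hc i)
        ((hn m).continuous_convolution_left _ (hc m) hF').locallyIntegrable x
  rw [assoc, assoc]
  congr 1
  rw [← convolution_flip]
  congr 1
  ext
  simp

/-- The kernel is even, so averaging annihilates the linear part A and only the remainder
contributes. -/
theorem norm_moll_sub_self_le {m : ℕ} {H : ℂ → ℂ} (hH : Continuous H) {z : ℂ} (A : ℂ →L[ℝ] ℂ)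
    {c : ℝ} (h : ∀ ζ, ‖ζ - z‖ ≤ scale m → ‖H ζ - H z - A (ζ - z)‖ ≤ c * ‖ζ - z‖) :
    ‖moll m H z - H z‖ ≤ c * scale m := by
  have hA0 : ∫ t, ker m (z - t) • A (t - z) = 0 := by
    have e1 : ∫ t, ker m (z - t) • A (t - z) = ∫ s, ker m s • A (-s) := by
      rw [← integral_sub_left_eq_self (fun s => ker m s • A (-s)) volume z]
      simp
    have e2 : ∫ s, ker m s • A (-s) = ∫ s, ker m s • A s := by
      rw [← integral_neg_eq_self]
      simp [ker_neg]
    have e3 : ∫ s, ker m s • A (-s) = - ∫ s, ker m s • A s := by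
      rw [← integral_neg]; simp
    rw [e1, e3]
    rw [e2] at e3
    have : (2 : ℂ) * ∫ s, ker m s • A s = 0 := by linear_combination e3
    simpa using this
  have hsm : ∀ G : ℂ → ℂ, Continuous G → Integrable fun t => ker m (z - t) • G t :=
    fun G hG => integrable_ker_smul m hG.locallyIntegrable z
  have e : moll m H z - H z = ∫ t, ker m (z - t) • (H t - H z - A (t - z)) := by
    simp_rw [smul_sub]
    rw [integral_sub, integral_sub, hA0, sub_zero, integral_smul_const, integral_ker_sub,
      one_smul, moll_apply]
    · exact hsm _ hH
    · exact hsm _ continuous_const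
    · exact (hsm _ hH).sub (hsm _ continuous_const)
    · exact hsm (fun t => A (t - z)) (by fun_prop)
  rw [e]
  calc _ ≤ ∫ t, ‖ker m (z - t) • (H t - H z - A (t - z))‖ := norm_integral_le_integral_norm _
    _ ≤ ∫ t, ker m (z - t) * (c * scale m) := by
      apply integral_mono_of_nonneg
      · exact Eventually.of_forall fun t => norm_nonneg _
      · exact (integrable_ker_sub m z).mul_const _
      · refine Eventually.of_forall fun t => ?_
        simp only [norm_smul, Real.norm_eq_abs, abs_of_nonneg (ker_nonneg _ _)]
        by_cases ht : scale m < ‖z - t‖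
        · simp [ker_eq_zero ht]
        · rw [not_lt, norm_sub_rev] at ht
          -- Nonnegativity of c is not assumed; it follows from the hypothesis at a point at
          -- distance `scale m` from z.
          have hc : 0 ≤ c := by
            have hs := scale_pos m
            have := (norm_nonneg _).trans (h (z + scale m) (by simp [abs_of_pos hs]))
            simp [abs_of_pos hs] at this
            nlinarith
          apply mul_le_mul_of_nonneg_left _ (ker_nonneg _ _)
          exact (h t ht).trans (by gcongr)
    _ = c * scale m := by rw [integral_mul_const, integral_ker_sub, one_mul]

variable {U : Set ℂ} {F P Q : ℂ → ℂ}

/-- Mean value inequality: on the disc of radius `scale k` the derivative of the mollification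
differs from the fixed linear map by at most the oscillations at z. -/
theorem norm_moll_increment_le (hF : LocallyIntegrable F) (hP : LocallyIntegrable P)
    (hQ : LocallyIntegrable Q) (h1 : HasWeakDeriv U 1 F P) (hI : HasWeakDeriv U I F Q)
    {k j : ℕ} (hj : j = k ∨ j = k + 1) {z ζ : ℂ}
    (hz : Metric.closedBall z (2 * scale k) ⊆ U) (hζ : ‖ζ - z‖ ≤ scale k) :
    ‖moll j F ζ - moll j F z - lin (P z) (Q z) (ζ - z)‖
      ≤ 8 * (osc k P z + osc k Q z) * ‖ζ - z‖ := by
  have hk := scale_pos k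
  have hs : scale j ≤ scale k := by
    rcases hj with rfl | rfl
    · rfl
    · rw [scale_succ]; linarith
  refine (convex_closedBall z (scale k)).norm_image_sub_le_of_norm_hasFDerivWithin_le'
    (f' := fun w => lin (moll j P w) (moll j Q w)) ?_ ?_ ?_ ?_
  · intro w hw
    refine (hasFDerivAt_moll hF h1 hI ?_).hasFDerivWithinAt
    refine subset_trans (Metric.closedBall_subset_closedBall' ?_) hz
    rw [Metric.mem_closedBall] at hw
    linarith
  · intro w hw
    rw [Metric.mem_closedBall, dist_eq_norm] at hw
    rw [lin_sub]
    refine (norm_lin_le _ _).trans ?_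
    have a1 := norm_moll_sub_le hj hP hw
    have a2 := norm_moll_sub_le hj hQ hw
    linarith
  · simpa using hk.le
  · simpa [dist_eq_norm] using hζ

/-- Mollifying either function at the other scale changes it little at z, and by commutation both
operations yield the same function. -/
theorem norm_moll_succ_sub_le (hF : LocallyIntegrable F) (hP : LocallyIntegrable P)
    (hQ : LocallyIntegrable Q) (h1 : HasWeakDeriv U 1 F P) (hI : HasWeakDeriv U I F Q)
    {k : ℕ} {z : ℂ} (hz : Metric.closedBall z (2 * scale k) ⊆ U) :
    ‖moll k F z - moll (k + 1) F z‖ ≤ 16 * (osc k P z + osc k Q z) * scale k := by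
  have hk := scale_pos k
  have e1 : ‖moll (k + 1) (moll k F) z - moll k F z‖
      ≤ 8 * (osc k P z + osc k Q z) * scale (k + 1) := by
    refine norm_moll_sub_self_le (continuous_moll k hF) (lin (P z) (Q z)) fun ζ hζ => ?_
    refine norm_moll_increment_le hF hP hQ h1 hI (Or.inl rfl) hz (hζ.trans ?_)
    rw [scale_succ]; linarith
  have e2 : ‖moll k (moll (k + 1) F) z - moll (k + 1) F z‖
      ≤ 8 * (osc k P z + osc k Q z) * scale k :=
    norm_moll_sub_self_le (continuous_moll (k + 1) hF) (lin (P z) (Q z)) fun ζ hζ =>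
      norm_moll_increment_le hF hP hQ h1 hI (Or.inr rfl) hz hζ
  rw [moll_moll_comm k (k + 1) hF] at e2
  have := norm_sub_le (moll (k + 1) (moll k F) z - moll (k + 1) F z)
    (moll (k + 1) (moll k F) z - moll k F z)
  rw [sub_sub_sub_cancel_left] at this
  have o1 := osc_nonneg k P z
  have o2 := osc_nonneg k Q z
  rw [scale_succ] at e1
  nlinarith

theorem norm_moll_sub_le_of_osc_le (hF : LocallyIntegrable F) (hP : LocallyIntegrable P)
    (hQ : LocallyIntegrable Q) (h1 : HasWeakDeriv U 1 F P) (hI : HasWeakDeriv U I F Q)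
    {N : ℕ} {z : ℂ} (hz : Metric.closedBall z (2 * scale N) ⊆ U) {ε : ℝ}
    (hosc : ∀ k, N ≤ k → osc k P z + osc k Q z ≤ ε)
    (hlim : Tendsto (fun k => moll k F z) atTop (𝓝 (F z))) {k : ℕ} (hk : N ≤ k) :
    ‖moll k F z - F z‖ ≤ 32 * ε * scale k := by
  have hanti : ∀ n, scale (k + n) ≤ scale N := fun n => by
    unfold scale
    exact pow_le_pow_of_le_one (by norm_num) (by norm_num) (by omega)
  -- The successive differences form a geometric series of ratio 1/2, which doubles the constant 16
  -- to 32.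
  have h := dist_le_of_le_geometric_of_tendsto (1 / 2) (16 * ε * scale k)
    (f := fun n => moll (k + n) F z) (by norm_num) (fun n => ?_) (a := F z) ?_ 0
  · rw [dist_eq_norm] at h
    simp only [add_zero, pow_zero] at h
    refine h.trans (le_of_eq ?_)
    ring
  · rw [dist_eq_norm]
    refine (norm_moll_succ_sub_le hF hP hQ h1 hI (k := k + n) ?_).trans ?_
    · refine subset_trans (Metric.closedBall_subset_closedBall ?_) hz
      linarith [hanti n]
    · have : scale (k + n) = scale k * (1 / 2) ^ n := by unfold scale; rw [pow_add]
      rw [mul_assoc (16 * ε), ← this]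
      have := scale_pos (k + n)
      have := hosc (k + n) (by omega)
      gcongr
  · exact hlim.comp (tendsto_atTop_mono (fun n => Nat.le_add_left n k) tendsto_id)

/-- F is replaced by its mollification at a scale comparable to |w - z|. The replacement costs an
error at each of z and w, and the increment of the mollification costs a third. In total 136 = 2 ·
32 · 2 + 8. -/
theorem norm_increment_le_of_osc_le (hF : LocallyIntegrable F) (hP : LocallyIntegrable P)
    (hQ : LocallyIntegrable Q) (h1 : HasWeakDeriv U 1 F P) (hI : HasWeakDeriv U I F Q)
    {N : ℕ} {z w : ℂ} (hz : Metric.closedBall z (2 * scale N) ⊆ U)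
    (hw : Metric.closedBall w (2 * scale N) ⊆ U) {ε : ℝ}
    (hoz : ∀ k, N ≤ k → osc k P z + osc k Q z ≤ ε)
    (how : ∀ k, N ≤ k → osc k P w + osc k Q w ≤ ε)
    (hlz : Tendsto (fun k => moll k F z) atTop (𝓝 (F z)))
    (hlw : Tendsto (fun k => moll k F w) atTop (𝓝 (F w)))
    (hd : ‖w - z‖ ≤ scale N) :
    ‖F w - F z - lin (P z) (Q z) (w - z)‖ ≤ 136 * ε * ‖w - z‖ := by
  rcases eq_or_ne w z with rfl | hne
  · simp
  have hpos : 0 < ‖w - z‖ := norm_pos_iff.2 (sub_ne_zero.2 hne)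
  have hsN := scale_pos N
  -- This selects the dyadic scale with |w - z| ≤ `scale (N + n)` < 2|w - z|.
  obtain ⟨n, hn1, hn2⟩ : ∃ n : ℕ, (1 / 2 : ℝ) ^ (n + 1) < ‖w - z‖ / scale N ∧
      ‖w - z‖ / scale N ≤ (1 / 2) ^ n :=
    exists_nat_pow_near_of_lt_one (by positivity) (by rw [div_le_one hsN]; exact hd)
      (by norm_num) (by norm_num)
  have hmul : ∀ m, scale (N + m) = (1 / 2) ^ m * scale N := fun m => by
    unfold scale; rw [pow_add]; ring
  have hlt : scale (N + n) < 2 * ‖w - z‖ := by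
    rw [lt_div_iff₀ hsN, ← hmul, ← add_assoc, scale_succ] at hn1
    linarith
  have hle : ‖w - z‖ ≤ scale (N + n) := by
    rw [div_le_iff₀ hsN, ← hmul] at hn2
    exact hn2
  have hsub : scale (N + n) ≤ scale N := by
    rw [hmul]
    exact mul_le_of_le_one_left hsN.le (pow_le_one₀ (by norm_num) (by norm_num))
  have a1 := norm_moll_sub_le_of_osc_le hF hP hQ h1 hI hz hoz hlz (Nat.le_add_right N n)
  have a2 := norm_moll_sub_le_of_osc_le hF hP hQ h1 hI hw how hlw (Nat.le_add_right N n)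
  have a3 := norm_moll_increment_le hF hP hQ h1 hI (k := N + n) (Or.inl rfl)
    (subset_trans (Metric.closedBall_subset_closedBall (by linarith)) hz) hle
  have ho := hoz (N + n) (Nat.le_add_right N n)
  have hε : 0 ≤ ε := (add_nonneg (osc_nonneg _ _ _) (osc_nonneg _ _ _)).trans ho
  have e : F w - F z - lin (P z) (Q z) (w - z)
      = -(moll (N + n) F w - F w) + (moll (N + n) F z - F z)
        + (moll (N + n) F w - moll (N + n) F z - lin (P z) (Q z) (w - z)) := by ring
  rw [e]
  refine (norm_add₃_le).trans ?_
  rw [norm_neg]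
  have b3 : 8 * (osc (N + n) P z + osc (N + n) Q z) * ‖w - z‖ ≤ 8 * ε * ‖w - z‖ := by gcongr
  have b1 : 32 * ε * scale (N + n) ≤ 32 * ε * (2 * ‖w - z‖) := by gcongr
  linarith

end

/-! ### Differentiability on large sets and the area inequality -/

theorem stronglyMeasurable_osc (k : ℕ) {P : ℂ → ℂ} (hP : StronglyMeasurable P) :
    StronglyMeasurable (osc k P) := by
  have e : osc k P = fun z => (∫ w, ({p : ℂ × ℂ | dist p.2 p.1 ≤ 2 * scale k}.indicator
      (fun p => ‖P p.2 - P p.1‖)) (z, w)) / scale k ^ 2 := by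
    ext z
    rw [osc, ← integral_indicator Metric.isClosed_closedBall.measurableSet]
    rfl
  rw [e]
  simp_rw [div_eq_mul_inv]
  refine StronglyMeasurable.mul_const (StronglyMeasurable.integral_prod_right' ?_) _
  refine StronglyMeasurable.indicator ?_ ?_
  · exact ((hP.comp_measurable measurable_snd).sub (hP.comp_measurable measurable_fst)).norm
  · exact (isClosed_le (by fun_prop) continuous_const).measurableSet

theorem tendsto_scale : Tendsto scale atTop (𝓝 0) :=
  tendsto_pow_atTop_nhds_zero_of_lt_one (by norm_num) (by norm_num)

theorem ae_tendsto_osc {P : ℂ → ℂ} (hP : LocallyIntegrable P) :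
    ∀ᵐ z, Tendsto (fun k => osc k P z) atTop (𝓝 0) := by
  filter_upwards [IsUnifLocDoublingMeasure.ae_tendsto_average_norm_sub volume hP 1] with z hz
  have hδ : Tendsto (fun k => 2 * scale k) atTop (𝓝[>] 0) := by
    refine tendsto_nhdsWithin_iff.2 ⟨by simpa using tendsto_scale.const_mul 2, ?_⟩
    exact Eventually.of_forall fun k => by have := scale_pos k; simp [this]
  have h := (hz (fun _ => z) _ hδ (Eventually.of_forall fun k => by
    have := scale_pos k
    simp [this.le])).const_mul (4 * Real.pi)
  rw [mul_zero] at h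
  refine h.congr fun k => ?_
  have hk := scale_pos k
  rw [setAverage_eq, osc, Measure.real, Complex.volume_closedBall]
  simp only [ENNReal.toReal_mul, ENNReal.toReal_pow, smul_eq_mul]
  rw [ENNReal.toReal_ofReal (by positivity)]
  have := Real.pi_pos
  simp only [ENNReal.coe_toReal, NNReal.coe_real_pi]
  field_simp
  norm_num

/-- The oscillations tend to zero almost everywhere by Lebesgue differentiation, hence uniformly off
a small set by Egorov. For points z, w in the remaining set the increment estimate is uniform, which
is differentiability relative to that set. Continuity of F makes the mollifications converge at
every point rather than almost everywhere. -/
theorem exists_hasFDerivWithinAt_local {U s : Set ℂ} {F P Q : ℂ → ℂ} (hU : IsOpen U)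
    (hFc : ContinuousOn F U) (hF : LocallyIntegrable F) (hP : LocallyIntegrable P)
    (hQ : LocallyIntegrable Q) (hPm : StronglyMeasurable P) (hQm : StronglyMeasurable Q)
    (h1 : HasWeakDeriv U 1 F P) (hI : HasWeakDeriv U I F Q) (hs : MeasurableSet s)
    (hsfin : volume s ≠ ⊤) {r : ℝ} (hr : 0 < r) (hsU : ∀ z ∈ s, Metric.closedBall z r ⊆ U)
    {ε : ℝ} (hε : 0 < ε) :
    ∃ t ⊆ s, MeasurableSet t ∧ volume t ≤ ENNReal.ofReal ε ∧
      ∀ z ∈ s \ t, HasFDerivWithinAt F (lin (P z) (Q z)) (s \ t) z := by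
  obtain ⟨t, hts, htm, hvol, hunif⟩ := tendstoUniformlyOn_of_ae_tendsto (μ := volume) (s := s)
    (f := fun k z => osc k P z + osc k Q z) (g := fun _ => 0)
    (fun k => (stronglyMeasurable_osc k hPm).add (stronglyMeasurable_osc k hQm))
    stronglyMeasurable_const hs hsfin (by
      filter_upwards [ae_tendsto_osc hP, ae_tendsto_osc hQ] with z h1 h2 _
      simpa using h1.add h2) hε
  refine ⟨t, hts, htm, hvol, fun z hz => ?_⟩
  have hlim : ∀ w ∈ s, Tendsto (fun k => moll k F w) atTop (𝓝 (F w)) := by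
    intro w hw
    refine ContDiffBump.convolution_tendsto_right (φ := bump) (g := fun _ => F) (k := fun _ => w)
      tendsto_scale (Eventually.of_forall fun _ => hF.aestronglyMeasurable) ?_ tendsto_const_nhds
    have : ContinuousAt F w :=
      hFc.continuousAt (hU.mem_nhds (hsU w hw (Metric.mem_closedBall_self hr.le)))
    exact this.tendsto.comp tendsto_snd
  refine .of_isLittleO (Asymptotics.isLittleO_iff.2 fun c hc => ?_)
  rw [Metric.tendstoUniformlyOn_iff] at hunif
  obtain ⟨N, hN⟩ := eventually_atTop.1
    ((hunif (c / 136) (by positivity)).and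
      ((tendsto_scale.const_mul 2).eventually (gt_mem_nhds (by simpa using hr))))
  have hosc : ∀ w ∈ s \ t, ∀ k, N ≤ k → osc k P w + osc k Q w ≤ c / 136 := by
    intro w hw k hk
    have := (hN k hk).1 w hw
    rw [dist_comm, Real.dist_0_eq_abs] at this
    exact (le_abs_self _).trans this.le
  have hNr : 2 * scale N ≤ r := (hN N le_rfl).2.le
  have hball : ∀ w ∈ s \ t, Metric.closedBall w (2 * scale N) ⊆ U := fun w hw =>
    (Metric.closedBall_subset_closedBall hNr).trans (hsU w hw.1)
  filter_upwards [self_mem_nhdsWithin,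
    nhdsWithin_le_nhds (Metric.closedBall_mem_nhds z (scale_pos N))] with w hw hwz
  rw [Metric.mem_closedBall, dist_eq_norm] at hwz
  refine (norm_increment_le_of_osc_le hF hP hQ h1 hI (hball z hz) (hball w hw) (hosc z hz)
    (hosc w hw) (hlim z hz.1) (hlim w hw.1) hwz).trans (le_of_eq ?_)
  ring

/-- Changing the functions off `Ω` or on null sets, and restricting to a subset. -/
theorem HasWeakDeriv.congr_of_ae {Ω U : Set ℂ} {v : ℂ} {f g f' g' : ℂ → ℂ}
    (h : HasWeakDeriv Ω v f g) (hUΩ : U ⊆ Ω) (hU : MeasurableSet U)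
    (hf : ∀ᵐ z ∂volume.restrict U, f' z = f z) (hg : ∀ᵐ z ∂volume.restrict U, g' z = g z) :
    HasWeakDeriv U v f' g' := by
  have loc : ∀ {a b : ℂ → ℂ}, LocallyIntegrableOn a Ω → (∀ᵐ z ∂volume.restrict U, b z = a z) →
      LocallyIntegrableOn b U := by
    intro a b ha hab z hz
    obtain ⟨s, hs, hint⟩ := (ha.mono_set hUΩ) z hz
    refine ⟨s ∩ U, inter_mem hs self_mem_nhdsWithin, ?_⟩
    refine (hint.mono_set inter_subset_left).congr ?_
    have : ∀ᵐ z ∂volume.restrict (s ∩ U), b z = a z :=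
      ae_restrict_of_ae_restrict_of_subset inter_subset_right hab
    exact this.mono fun _ h => h.symm
  refine ⟨loc h.locallyIntegrable hf, loc h.locallyIntegrable_deriv hg, fun φ hφ hc hs => ?_⟩
  have e := h.integral_eq φ hφ hc (hs.trans hUΩ)
  rw [ae_restrict_iff' hU] at hf hg
  have e1 : ∫ z, φ z • g' z = ∫ z, φ z • g z := by
    apply integral_congr_ae
    filter_upwards [hg] with z hz
    by_cases hzU : z ∈ U
    · rw [hz hzU]
    · rw [image_eq_zero_of_notMem_tsupport fun hh => hzU (hs hh), zero_smul, zero_smul]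
  have e2 : ∫ z, (fderiv ℝ φ z v) • f' z = ∫ z, (fderiv ℝ φ z v) • f z := by
    apply integral_congr_ae
    filter_upwards [hf] with z hz
    by_cases hzU : z ∈ U
    · rw [hz hzU]
    · rw [image_eq_zero_of_notMem_tsupport fun hh => hzU (hs (tsupport_fderiv_subset ℝ hh))]
      simp
  rw [e1, e2, e]

/-- Local sets are patched: countably many balls cover Ω, and in each ball the exceptional sets of
measure at most 1/(n + 1) have null intersection. -/
theorem exists_hasFDerivWithinAt_seq {Ω : Set ℂ} {f p q : ℂ → ℂ} (hΩ : IsOpen Ω)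
    (hf : ContinuousOn f Ω) (h1 : HasWeakDeriv Ω 1 f p) (hI : HasWeakDeriv Ω I f q)
    (hp : StronglyMeasurable p) (hq : StronglyMeasurable q) :
    ∃ E : ℕ → Set ℂ, (∀ n, MeasurableSet (E n)) ∧ (∀ n, E n ⊆ Ω) ∧ volume (Ω \ ⋃ n, E n) = 0 ∧
      ∀ n, ∀ z ∈ E n, HasFDerivWithinAt f (lin (p z) (q z)) (E n) z := by
  have hloc : ∀ z ∈ Ω, ∃ r > 0, Metric.ball z r ⊆ Ω ∧ ∀ ε : ℝ, 0 < ε → ∃ t ⊆ Metric.ball z r,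
      MeasurableSet t ∧ volume t ≤ ENNReal.ofReal ε ∧
      ∀ w ∈ Metric.ball z r \ t,
        HasFDerivWithinAt f (lin (p w) (q w)) (Metric.ball z r \ t) w := by
    intro z hz
    obtain ⟨R, hR, hRΩ⟩ := Metric.nhds_basis_closedBall.mem_iff.1 (hΩ.mem_nhds hz)
    have hB : IsCompact (Metric.closedBall z R) := isCompact_closedBall z R
    have hBm : MeasurableSet (Metric.closedBall z R) := hB.measurableSet
    -- Extension by zero off a closed disc makes the functions locally integrable on the whole
    -- plane, as mollification requires.
    have hint : ∀ {g : ℂ → ℂ}, LocallyIntegrableOn g Ω →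
        LocallyIntegrable ((Metric.closedBall z R).indicator g) := fun hg =>
      ((hg.integrableOn_compact_subset hRΩ hB).integrable_indicator hBm).locallyIntegrable
    have hae : ∀ g : ℂ → ℂ, ∀ᵐ w ∂volume.restrict (Metric.ball z R),
        (Metric.closedBall z R).indicator g w = g w := fun g => by
      rw [ae_restrict_iff' Metric.isOpen_ball.measurableSet]
      exact Eventually.of_forall fun w hw =>
        indicator_of_mem (Metric.ball_subset_closedBall hw) _
    have hUΩ : Metric.ball z R ⊆ Ω := Metric.ball_subset_closedBall.trans hRΩ
    have hUm : MeasurableSet (Metric.ball z R) := Metric.isOpen_ball.measurableSet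
    refine ⟨R / 3, by positivity, (Metric.ball_subset_ball (by linarith)).trans hUΩ,
      fun ε hε => ?_⟩
    obtain ⟨t, ht, htm, hvol, hd⟩ := exists_hasFDerivWithinAt_local (U := Metric.ball z R)
      (s := Metric.ball z (R / 3)) Metric.isOpen_ball
      ((hf.mono hUΩ).congr fun w hw => indicator_of_mem (Metric.ball_subset_closedBall hw) f)
      (hint h1.locallyIntegrable) (hint h1.locallyIntegrable_deriv)
      (hint hI.locallyIntegrable_deriv) (hp.indicator hBm) (hq.indicator hBm)
      (h1.congr_of_ae hUΩ hUm (hae f) (hae p)) (hI.congr_of_ae hUΩ hUm (hae f) (hae q))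
      Metric.isOpen_ball.measurableSet measure_ball_lt_top.ne (r := R / 3) (by positivity)
      (fun w hw v hv => by
        rw [Metric.mem_ball] at hw ⊢
        rw [Metric.mem_closedBall] at hv
        linarith [dist_triangle v w z]) hε
    have hin : Metric.ball z (R / 3) ⊆ Metric.closedBall z R :=
      (Metric.ball_subset_ball (by linarith)).trans Metric.ball_subset_closedBall
    refine ⟨t, ht, htm, hvol, fun w hw => ?_⟩
    have := hd w hw
    rw [indicator_of_mem (hin hw.1), indicator_of_mem (hin hw.1)] at this
    exact this.congr (fun v hv => (indicator_of_mem (hin hv.1) f).symm)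
      (indicator_of_mem (hin hw.1) f).symm
  choose! r hr hrΩ ht using hloc
  choose! t hts htm htv htd using ht
  obtain ⟨S, hSΩ, hSc, hcov⟩ := TopologicalSpace.countable_cover_nhdsWithin
    (f := fun z => Metric.ball z (r z)) (s := Ω)
    fun z hz => mem_nhdsWithin_of_mem_nhds (Metric.ball_mem_nhds z (hr z hz))
  let ε : ℕ → ℝ := fun n => 1 / ((n : ℝ) + 1)
  have hεpos : ∀ n, 0 < ε n := fun n => Nat.one_div_pos_of_nat
  let 𝓔 : Set (Set ℂ) :=
    insert ∅ ((fun x : ℂ × ℕ => Metric.ball x.1 (r x.1) \ t x.1 (ε x.2)) '' (S ×ˢ univ))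
  have hc : 𝓔.Countable := ((hSc.prod countable_univ).image _).insert _
  obtain ⟨E, hE⟩ := hc.exists_eq_range (insert_nonempty _ _)
  have hmem : ∀ n, E n = ∅ ∨ ∃ z ∈ Ω, ∃ m, E n = Metric.ball z (r z) \ t z (ε m) := by
    intro n
    have : E n ∈ 𝓔 := hE ▸ mem_range_self n
    rcases this with h | ⟨⟨z, m⟩, ⟨hz, -⟩, h⟩
    · exact Or.inl h
    · exact Or.inr ⟨z, hSΩ hz, m, h.symm⟩
  refine ⟨E, fun n => ?_, fun n => ?_, ?_, fun n => ?_⟩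
  · rcases hmem n with h | ⟨z, hz, m, h⟩
    · rw [h]; exact MeasurableSet.empty
    · rw [h]; exact Metric.isOpen_ball.measurableSet.diff (htm z hz _ (hεpos m))
  · rcases hmem n with h | ⟨z, hz, m, h⟩
    · rw [h]; exact empty_subset _
    · rw [h]; exact sdiff_subset.trans (hrΩ z hz)
  · have hsub : Ω \ ⋃ n, E n ⊆ ⋃ z ∈ S, ⋂ m, t z (ε m) := by
      intro w hw
      obtain ⟨z, hz, hwz⟩ := mem_iUnion₂.1 (hcov hw.1)
      refine mem_iUnion₂.2 ⟨z, hz, mem_iInter.2 fun m => ?_⟩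
      by_contra hcon
      have : Metric.ball z (r z) \ t z (ε m) ∈ 𝓔 :=
        mem_insert_of_mem _ ⟨(z, m), ⟨hz, mem_univ _⟩, rfl⟩
      rw [hE] at this
      obtain ⟨n, hn⟩ := this
      exact hw.2 (mem_iUnion.2 ⟨n, hn ▸ ⟨hwz, hcon⟩⟩)
    refine measure_mono_null hsub ((measure_biUnion_null_iff hSc).2 fun z hz => ?_)
    have hlim : Tendsto (fun n => ENNReal.ofReal (ε n)) atTop (𝓝 0) := by
      have := ENNReal.tendsto_ofReal (tendsto_one_div_add_atTop_nhds_zero_nat (𝕜 := ℝ))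
      rwa [ENNReal.ofReal_zero] at this
    refine le_antisymm (ge_of_tendsto' hlim fun n => ?_) zero_le
    exact (measure_mono (iInter_subset _ n)).trans (htv z (hSΩ hz) _ (hεpos n))
  · rcases hmem n with h | ⟨z, hz, m, h⟩
    · rw [h]; simp
    · rw [h]; exact htd z hz _ (hεpos m)

/-- Change of variables is an equality on each piece. Only an inequality remains in the end, because
f may send the null set left uncovered to a set of positive measure. -/
theorem lintegral_jacobian_le_of_stronglyMeasurable {Ω : Set ℂ} {f p q : ℂ → ℂ} (hΩ : IsOpen Ω)
    (hf : ContinuousOn f Ω) (hinj : InjOn f Ω) (h1 : HasWeakDeriv Ω 1 f p)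
    (hI : HasWeakDeriv Ω I f q) (hp : StronglyMeasurable p) (hq : StronglyMeasurable q) :
    ∫⁻ z in Ω, ENNReal.ofReal |(lin (p z) (q z)).det| ≤ volume (f '' Ω) := by
  obtain ⟨E, hEm, hEΩ, hE0, hd⟩ := exists_hasFDerivWithinAt_seq hΩ hf h1 hI hp hq
  -- Disjoint pieces have disjoint images by injectivity, so the areas add up.
  have hDm : ∀ n, MeasurableSet (disjointed E n) := fun n => MeasurableSet.disjointed hEm n
  have hDE : ∀ n, disjointed E n ⊆ E n := disjointed_subset E
  have hdD : ∀ n, ∀ z ∈ disjointed E n,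
      HasFDerivWithinAt f (lin (p z) (q z)) (disjointed E n) z := fun n z hz =>
    (hd n z (hDE n hz)).mono (hDE n)
  have hinjD : ∀ n, InjOn f (disjointed E n) := fun n =>
    hinj.mono ((hDE n).trans (hEΩ n))
  calc ∫⁻ z in Ω, ENNReal.ofReal |(lin (p z) (q z)).det|
      = ∫⁻ z in ⋃ n, disjointed E n, ENNReal.ofReal |(lin (p z) (q z)).det| := by
        apply setLIntegral_congr
        rw [iUnion_disjointed]
        refine (ae_eq_set.2 ⟨hE0, ?_⟩)
        rw [sdiff_eq_empty.2 (iUnion_subset hEΩ), measure_empty]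
    _ = ∑' n, ∫⁻ z in disjointed E n, ENNReal.ofReal |(lin (p z) (q z)).det| :=
        lintegral_iUnion hDm (disjoint_disjointed E) _
    _ = ∑' n, volume (f '' disjointed E n) := by
        congr 1; ext1 n
        exact lintegral_abs_det_fderiv_eq_addHaar_image volume (hDm n) (hdD n) (hinjD n)
    _ = volume (⋃ n, f '' disjointed E n) := by
        rw [measure_iUnion]
        · intro i j hij
          refine disjoint_left.2 ?_
          rintro _ ⟨x, hx, rfl⟩ ⟨y, hy, hxy⟩
          have := hinj (hEΩ j (hDE j hy)) (hEΩ i (hDE i hx)) hxy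
          exact disjoint_left.1 (disjoint_disjointed E hij) hx (this ▸ hy)
        · exact fun n => measurable_image_of_fderivWithin (hDm n) (hdD n) (hinjD n)
    _ ≤ volume (f '' Ω) := by
        refine measure_mono (iUnion_subset fun n => image_mono ((hDE n).trans (hEΩ n)))

/-- The area inequality: the integral of the Jacobian of an injective continuous Sobolev map is at
most the area of its image. -/
theorem lintegral_jacobian_le {Ω : Set ℂ} {f p q : ℂ → ℂ} (hΩ : IsOpen Ω)
    (hf : ContinuousOn f Ω) (hinj : InjOn f Ω) (h1 : HasWeakDeriv Ω 1 f p)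
    (hI : HasWeakDeriv Ω I f q) :
    ∫⁻ z in Ω, ENNReal.ofReal |(lin (p z) (q z)).det| ≤ volume (f '' Ω) := by
  have hp := h1.locallyIntegrable_deriv.aestronglyMeasurable
  have hq := hI.locallyIntegrable_deriv.aestronglyMeasurable
  have hpe := hp.ae_eq_mk
  have hqe := hq.ae_eq_mk
  have hrefl : ∀ᵐ z ∂volume.restrict Ω, f z = f z := Eventually.of_forall fun _ => rfl
  refine le_trans (le_of_eq ?_) (lintegral_jacobian_le_of_stronglyMeasurable hΩ hf hinj
    (h1.congr_of_ae subset_rfl hΩ.measurableSet hrefl (hpe.mono fun _ h => h.symm))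
    (hI.congr_of_ae subset_rfl hΩ.measurableSet hrefl (hqe.mono fun _ h => h.symm))
    hp.stronglyMeasurable_mk hq.stronglyMeasurable_mk)
  apply lintegral_congr_ae
  filter_upwards [hpe, hqe] with z h1 h2
  rw [h1, h2]

/-! ### Integrals of weak derivatives in terms of boundary values -/

section

/-- `(s, t)` are real coordinates of the plane with inverse `e`, and `v` is the unit vector in the
direction of `s`. -/
structure IsCoord (e : ℝ × ℝ → ℂ) (s t : ℂ →L[ℝ] ℝ) (v : ℂ) : Prop where
  continuous : Continuous e
  measurePreserving : MeasurePreserving e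
  measurableEmbedding : MeasurableEmbedding e
  fst : ∀ x y, s (e (x, y)) = x
  snd : ∀ x y, t (e (x, y)) = y
  apply_coords : ∀ z, e (s z, t z) = z
  fst_dir : s v = 1
  snd_dir : t v = 0

theorem isCoord_re_im : IsCoord (fun x => (x.1 : ℂ) + x.2 * I) reCLM imCLM 1 := by
  have h : (fun x : ℝ × ℝ => (x.1 : ℂ) + x.2 * I) = Complex.measurableEquivRealProd.symm := by
    ext x
    apply Complex.ext <;> simp [Complex.measurableEquivRealProd_symm_apply]
  refine ⟨by fun_prop, ?_, ?_, by simp, by simp, by simp [Complex.re_add_im], by simp, by simp⟩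
  · rw [h]; exact Complex.volume_preserving_equiv_real_prod.symm
  · rw [h]; exact Complex.measurableEquivRealProd.symm.measurableEmbedding

theorem isCoord_im_re : IsCoord (fun x => (x.2 : ℂ) + x.1 * I) imCLM reCLM I := by
  have h : (fun x : ℝ × ℝ => (x.2 : ℂ) + x.1 * I)
      = (fun x : ℝ × ℝ => (x.1 : ℂ) + x.2 * I) ∘ Prod.swap := rfl
  refine ⟨by fun_prop, ?_, ?_, by simp, by simp, by simp [Complex.re_add_im], by simp, by simp⟩
  · rw [h]; exact isCoord_re_im.measurePreserving.comp Measure.measurePreserving_swap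
  · rw [h]
    exact isCoord_re_im.measurableEmbedding.comp MeasurableEquiv.prodComm.measurableEmbedding

/-- The derivative of the smooth transition function. -/
noncomputable def bumpDeriv : ℝ → ℝ := deriv Real.smoothTransition

theorem hasDerivAt_smoothTransition (x : ℝ) :
    HasDerivAt Real.smoothTransition (bumpDeriv x) x :=
  ((Real.smoothTransition.contDiff (n := 1)).differentiable (by simp) x).hasDerivAt

theorem continuous_bumpDeriv : Continuous bumpDeriv :=
  (Real.smoothTransition.contDiff (n := 1)).continuous_deriv (by simp)

theorem bumpDeriv_eq_zero {x : ℝ} (hx : x ∉ Icc (0 : ℝ) 1) : bumpDeriv x = 0 := by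
  rw [mem_Icc, not_and_or, not_le, not_le] at hx
  rcases hx with hx | hx
  · have : Real.smoothTransition =ᶠ[𝓝 x] fun _ => 0 := by
      filter_upwards [gt_mem_nhds hx] with y hy
      exact Real.smoothTransition.zero_of_nonpos hy.le
    rw [bumpDeriv, this.deriv_eq, deriv_const]
  · have : Real.smoothTransition =ᶠ[𝓝 x] fun _ => 1 := by
      filter_upwards [lt_mem_nhds hx] with y hy
      exact Real.smoothTransition.one_of_one_le hy.le
    rw [bumpDeriv, this.deriv_eq, deriv_const]

theorem integral_bumpDeriv : ∫ u in Icc (0 : ℝ) 1, bumpDeriv u = 1 := by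
  rw [integral_Icc_eq_integral_Ioc, ← intervalIntegral.integral_of_le zero_le_one,
    intervalIntegral.integral_eq_sub_of_hasDerivAt (fun x _ => hasDerivAt_smoothTransition x)
      (continuous_bumpDeriv.intervalIntegrable _ _)]
  simp [Real.smoothTransition.zero, Real.smoothTransition.one]

theorem integral_scaled_bumpDeriv {n : ℝ} (hn : 0 < n) (c : ℝ) (H : ℝ → ℂ) :
    ∫ x, (n * bumpDeriv (n * x + c)) • H x
      = ∫ u in Icc (0 : ℝ) 1, bumpDeriv u • H ((u - c) / n) := by
  have h1 : ∫ x, (n * bumpDeriv (n * x + c)) • H x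
      = ∫ x, (fun y => n • (bumpDeriv (y + c) • H (y / n))) (n * x) := by
    congr 1; ext1 x
    simp only [mul_smul]
    rw [mul_div_cancel_left₀ _ hn.ne']
  rw [h1, Measure.integral_comp_mul_left (fun y => n • (bumpDeriv (y + c) • H (y / n))) n, integral_smul, smul_smul, abs_of_pos (by positivity),
    inv_mul_cancel₀ hn.ne', one_smul]
  have h2 := integral_add_right_eq_self (μ := volume)
    (fun u : ℝ => bumpDeriv u • H ((u - c) / n)) c
  simp only [add_sub_cancel_right] at h2
  rw [h2, setIntegral_eq_integral_of_forall_compl_eq_zero]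
  intro u hu
  rw [bumpDeriv_eq_zero hu, zero_smul]

/-- The parametric integral is continuous in τ = 1/n, and at τ = 0 it equals `H x` since the bump
has integral 1. -/
theorem tendsto_integral_bumpDeriv {H : ℝ → ℂ} (hH : Continuous H) (x d : ℝ) :
    Tendsto (fun n : ℕ => ∫ u in Icc (0 : ℝ) 1, bumpDeriv u • H (x + (u - d) * (n : ℝ)⁻¹))
      atTop (𝓝 (H x)) := by
  have hc : Continuous fun τ : ℝ => ∫ u in Icc (0 : ℝ) 1, bumpDeriv u • H (x + (u - d) * τ) := by
    apply continuous_parametric_integral_of_continuous _ isCompact_Icc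
    have := continuous_bumpDeriv
    simp only [Function.uncurry_def]
    fun_prop
  have h := (hc.tendsto 0).comp (tendsto_inv_atTop_nhds_zero_nat (𝕜 := ℝ))
  simp only [Function.comp_def, mul_zero, add_zero, integral_smul_const, integral_bumpDeriv,
    one_smul] at h
  exact h

/-- A smooth cutoff function of the interval `(0, a)`. -/
noncomputable def cutoff (a : ℝ) (n : ℕ) (x : ℝ) : ℝ :=
  Real.smoothTransition (n * x + (-1)) - Real.smoothTransition (n * x + (2 - n * a))

theorem contDiff_cutoff (a : ℝ) (n : ℕ) : ContDiff ℝ ∞ (cutoff a n) := by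
  unfold cutoff
  exact (Real.smoothTransition.contDiff.comp (by fun_prop)).sub
    (Real.smoothTransition.contDiff.comp (by fun_prop))

theorem hasDerivAt_cutoff (a : ℝ) (n : ℕ) (x : ℝ) :
    HasDerivAt (cutoff a n)
      (n * bumpDeriv (n * x + (-1)) - n * bumpDeriv (n * x + (2 - n * a))) x := by
  have h : ∀ c : ℝ, HasDerivAt (fun x : ℝ => Real.smoothTransition (n * x + c))
      (n * bumpDeriv (n * x + c)) x := by
    intro c
    have h2 : HasDerivAt (fun x : ℝ => n * x + c) n x := by
      simpa using ((hasDerivAt_id x).const_mul (n : ℝ)).add_const c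
    have := (hasDerivAt_smoothTransition (n * x + c)).comp x h2
    rwa [mul_comm] at this
  exact (h _).sub (h _)

theorem abs_cutoff_le (a : ℝ) (n : ℕ) (x : ℝ) : |cutoff a n x| ≤ 1 := by
  unfold cutoff
  rw [abs_le]
  constructor <;> linarith [Real.smoothTransition.nonneg (n * x + (-1)),
    Real.smoothTransition.nonneg (n * x + (2 - n * a)),
    Real.smoothTransition.le_one (n * x + (-1)),
    Real.smoothTransition.le_one (n * x + (2 - n * a))]

theorem tsupport_cutoff {a : ℝ} {n : ℕ} (hn : 4 ≤ n * a) (hn0 : 0 < n) :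
    tsupport (cutoff a n) ⊆ Icc (1 / (n : ℝ)) (a - 1 / n) := by
  refine closure_minimal (fun x hx => ?_) isClosed_Icc
  have hn' : (0 : ℝ) < n := by exact_mod_cast hn0
  by_contra hc
  apply hx
  unfold cutoff
  rw [mem_Icc, not_and_or, not_le, not_le] at hc
  rcases hc with hc | hc
  · rw [lt_div_iff₀ hn'] at hc
    rw [Real.smoothTransition.zero_of_nonpos (by nlinarith),
      Real.smoothTransition.zero_of_nonpos (by nlinarith), sub_zero]
  · have h1 : n * a - 1 < n * x := by
      have := mul_lt_mul_of_pos_left hc hn'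
      rwa [mul_sub, mul_one_div_cancel hn'.ne'] at this
    rw [Real.smoothTransition.one_of_one_le (by linarith),
      Real.smoothTransition.one_of_one_le (by linarith), sub_self]

theorem tendsto_cutoff {a x : ℝ} (hx : x ∈ Ioo 0 a) :
    Tendsto (fun n => cutoff a n x) atTop (𝓝 1) := by
  have h1 : Tendsto (fun n : ℕ => (n : ℝ) * x) atTop atTop :=
    tendsto_natCast_atTop_atTop.atTop_mul_const hx.1
  have h2 : Tendsto (fun n : ℕ => (n : ℝ) * (a - x)) atTop atTop :=
    tendsto_natCast_atTop_atTop.atTop_mul_const (sub_pos.2 hx.2)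
  refine tendsto_const_nhds.congr' ?_
  filter_upwards [h1.eventually_ge_atTop 2, h2.eventually_ge_atTop 2] with n hn1 hn2
  rw [cutoff, Real.smoothTransition.one_of_one_le (by linarith),
    Real.smoothTransition.zero_of_nonpos (by linarith), sub_zero]

/-- The cutoff rises on [1/n, 2/n] and falls on [a - 2/n, a - 1/n], so its derivative tends to the
difference of the point masses at 0 and a. The shifts -1 and 2 are the positions of these intervals
in the rescaled variable. -/
theorem tendsto_integral_deriv_cutoff {H : ℝ → ℂ} (hH : Continuous H) {a : ℝ} :
    Tendsto (fun n => ∫ x, (deriv (cutoff a n) x) • H x) atTop (𝓝 (H 0 - H a)) := by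
  have h1 := tendsto_integral_bumpDeriv hH 0 (-1)
  have h2 := tendsto_integral_bumpDeriv hH a 2
  refine (h1.sub h2).congr' ?_
  filter_upwards [eventually_gt_atTop 0] with n hn
  have hn' : (0 : ℝ) < n := by exact_mod_cast hn
  have hcs : ∀ c : ℝ, Integrable fun x : ℝ => (n * bumpDeriv (n * x + c)) • H x := by
    intro c
    have hb := continuous_bumpDeriv
    apply Continuous.integrable_of_hasCompactSupport (by fun_prop)
    refine HasCompactSupport.intro (isCompact_Icc (a := -c / n) (b := (1 - c) / n)) fun x hx => ?_
    rw [bumpDeriv_eq_zero, mul_zero, zero_smul]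
    contrapose! hx
    constructor
    · rw [div_le_iff₀ hn']; linarith [hx.1]
    · rw [le_div_iff₀ hn']; linarith [hx.2]
  have e : ∀ x, deriv (cutoff a n) x • H x = (n * bumpDeriv (n * x + (-1))) • H x
      - (n * bumpDeriv (n * x + (2 - n * a))) • H x := by
    intro x
    rw [(hasDerivAt_cutoff a n x).deriv, sub_smul]
  simp_rw [e]
  rw [integral_sub (hcs _) (hcs _), integral_scaled_bumpDeriv hn', integral_scaled_bumpDeriv hn']
  congr 2
  · ext1 u; congr 2; field_simp; ring
  · ext1 u; congr 2; field_simp; ring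

variable {e : ℝ × ℝ → ℂ} {s t : ℂ →L[ℝ] ℝ} {v : ℂ}

/-- The open coordinate rectangle `0 < s < a`, `0 < t < b`. -/
def coordRect (s t : ℂ →L[ℝ] ℝ) (a b : ℝ) : Set ℂ := {z | s z ∈ Ioo 0 a ∧ t z ∈ Ioo 0 b}

theorem isOpen_coordRect (s t : ℂ →L[ℝ] ℝ) (a b : ℝ) : IsOpen (coordRect s t a b) :=
  (isOpen_Ioo.preimage s.continuous).inter (isOpen_Ioo.preimage t.continuous)

theorem IsCoord.integral_eq (hc : IsCoord e s t v) (f : ℂ → ℂ) : ∫ z, f z = ∫ x, f (e x) :=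
  (hc.measurePreserving.integral_comp hc.measurableEmbedding f).symm

/-- The test functions are products of a cutoff in s and χ in t. Integrability of G up to the
boundary permits dominated convergence on one side; on the other the derivative of the cutoff
produces the two boundary terms. -/
theorem integral_test_of_continuous (hc : IsCoord e s t v) {a b : ℝ} (ha : 0 < a)
    {g G : ℂ → ℂ} (hg : Continuous g) (hw : HasWeakDeriv (coordRect s t a b) v g G)
    (hG : IntegrableOn G (coordRect s t a b)) {χ : ℝ → ℝ} (hχ : ContDiff ℝ ∞ χ)
    (hχc : HasCompactSupport χ) (hχs : tsupport χ ⊆ Ioo 0 b) :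
    ∫ z in coordRect s t a b, χ (t z) • G z
      = ∫ y in Icc 0 b, χ y • (g (e (a, y)) - g (e (0, y))) := by
  set Ω := coordRect s t a b with hΩ
  have hΩm : MeasurableSet Ω := (isOpen_coordRect s t a b).measurableSet
  have hχ0 : ∀ y, y ∉ Icc 0 b → χ y = 0 := fun y hy =>
    image_eq_zero_of_notMem_tsupport fun h => hy (Ioo_subset_Icc_self (hχs h))
  have hχcont := hχ.continuous
  set H : ℝ → ℂ := fun x => ∫ y in Icc 0 b, χ y • g (e (x, y)) with hH
  have hec := hc.continuous
  have hHc : Continuous H := by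
    apply continuous_parametric_integral_of_continuous _ isCompact_Icc
    simp only [Function.uncurry_def]
    fun_prop
  let φ : ℕ → ℂ → ℝ := fun n z => cutoff a n (s z) * χ (t z)
  have hφs : ∀ n : ℕ, 4 ≤ n * a → 0 < n → HasCompactSupport (φ n) ∧ tsupport (φ n) ⊆ Ω := by
    intro n hn hn0
    have hn' : (0 : ℝ) < n := by exact_mod_cast hn0
    have hK : IsCompact (e '' (Icc (1 / (n : ℝ)) (a - 1 / n) ×ˢ tsupport χ)) :=
      (isCompact_Icc.prod hχc).image hec
    have hsub : tsupport (φ n) ⊆ e '' (Icc (1 / (n : ℝ)) (a - 1 / n) ×ˢ tsupport χ) := by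
      refine closure_minimal (fun z hz => ?_) hK.isClosed
      refine ⟨(s z, t z), ⟨tsupport_cutoff hn hn0 (subset_tsupport _ ?_),
        subset_tsupport _ ?_⟩, hc.apply_coords z⟩
      · exact left_ne_zero_of_mul hz
      · exact right_ne_zero_of_mul hz
    refine ⟨HasCompactSupport.of_support_subset_isCompact hK ((subset_tsupport _).trans hsub),
      hsub.trans ?_⟩
    rintro _ ⟨⟨x, y⟩, ⟨hx, hy⟩, rfl⟩
    refine ⟨?_, ?_⟩
    · rw [hc.fst]
      have : (0 : ℝ) < 1 / n := by positivity
      exact ⟨by linarith [hx.1], by linarith [hx.2]⟩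
    · rw [hc.snd]; exact hχs hy
  have hφd : ∀ n, ContDiff ℝ ∞ (φ n) := fun n =>
    ((contDiff_cutoff a n).comp s.contDiff).mul (hχ.comp t.contDiff)
  have hφv : ∀ n z, fderiv ℝ (φ n) z v = deriv (cutoff a n) (s z) * χ (t z) := by
    intro n z
    have h1 : HasFDerivAt (fun z => cutoff a n (s z)) (deriv (cutoff a n) (s z) • s) z :=
      (hasDerivAt_cutoff a n (s z)).differentiableAt.hasDerivAt.comp_hasFDerivAt z s.hasFDerivAt
    have h2 : HasFDerivAt (fun z => χ (t z)) (deriv χ (t z) • t) z :=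
      (hχ.differentiable (by simp) (t z)).hasDerivAt.comp_hasFDerivAt z t.hasFDerivAt
    have h3 : HasFDerivAt (φ n) _ z := h1.mul h2
    rw [h3.fderiv]
    simp [hc.fst_dir, hc.snd_dir, mul_comm]
  have hright : ∀ n : ℕ, 4 ≤ n * a → 0 < n →
      ∫ z, (fderiv ℝ (φ n) z v) • g z = ∫ x, deriv (cutoff a n) x • H x := by
    intro n hn hn0
    have hηc : HasCompactSupport (deriv (cutoff a n)) :=
      HasCompactSupport.deriv (isCompact_Icc.of_isClosed_subset (isClosed_tsupport _)
        (tsupport_cutoff hn hn0))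
    have hηcont : Continuous (deriv (cutoff a n)) :=
      (contDiff_cutoff a n).continuous_deriv (by simp)
    rw [hc.integral_eq]
    simp_rw [hφv]
    rw [Measure.volume_eq_prod, integral_prod]
    · congr 1; ext1 x
      simp only [hc.fst, hc.snd, mul_smul, hH]
      rw [integral_smul, setIntegral_eq_integral_of_forall_compl_eq_zero]
      intro y hy
      rw [hχ0 y hy, zero_smul]
    · simp only [← Measure.volume_eq_prod]
      apply Continuous.integrable_of_hasCompactSupport (by fun_prop)
      refine HasCompactSupport.intro (hηc.isCompact.prod hχc.isCompact) fun x hx => ?_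
      rw [mem_prod, not_and_or] at hx
      rw [← Prod.mk.eta (p := x), hc.fst, hc.snd]
      rcases hx with hx | hx
      · rw [image_eq_zero_of_notMem_tsupport hx, zero_mul, zero_smul]
      · rw [image_eq_zero_of_notMem_tsupport hx, mul_zero, zero_smul]
  have h4 : Tendsto (fun n : ℕ => (n : ℝ) * a) atTop atTop :=
    tendsto_natCast_atTop_atTop.atTop_mul_const ha
  obtain ⟨C, hC⟩ := hχcont.bounded_above_of_compact_support hχc
  have hleft : Tendsto (fun n => ∫ z, φ n z • G z) atTop
      (𝓝 (∫ z in Ω, χ (t z) • G z)) := by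
    have hset : Tendsto (fun n => ∫ z in Ω, φ n z • G z) atTop
        (𝓝 (∫ z in Ω, χ (t z) • G z)) := by
      refine tendsto_integral_of_dominated_convergence (fun z => C * ‖G z‖) (fun n => ?_)
        (hG.norm.const_mul C) (fun n => Eventually.of_forall fun z => ?_) ?_
      · exact (hφd n).continuous.aestronglyMeasurable.smul hG.aestronglyMeasurable
      · rw [norm_smul]
        gcongr
        simp only [φ, norm_mul, Real.norm_eq_abs]
        exact (mul_le_of_le_one_left (abs_nonneg _) (abs_cutoff_le a n _)).trans (hC _)
      · rw [ae_restrict_iff' hΩm]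
        refine Eventually.of_forall fun z hz => ?_
        have := ((tendsto_cutoff hz.1).mul_const (χ (t z))).smul_const (G z)
        rwa [one_mul] at this
    refine hset.congr' ?_
    filter_upwards [h4.eventually_ge_atTop 4, eventually_gt_atTop 0] with n hn hn0
    refine setIntegral_eq_integral_of_forall_compl_eq_zero fun z hz => ?_
    rw [image_eq_zero_of_notMem_tsupport fun h => hz ((hφs n hn hn0).2 h), zero_smul]
  have hlim : Tendsto (fun n => ∫ z, φ n z • G z) atTop (𝓝 (-(H 0 - H a))) := by
    refine (tendsto_integral_deriv_cutoff hHc (a := a)).neg.congr' ?_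
    filter_upwards [h4.eventually_ge_atTop 4, eventually_gt_atTop 0] with n hn hn0
    rw [hw.integral_eq (φ n) (hφd n) (hφs n hn hn0).1 (hφs n hn hn0).2,
      hright n hn hn0]
  rw [tendsto_nhds_unique hleft hlim, neg_sub, hH]
  simp only [smul_sub]
  rw [integral_sub]
  · exact (Continuous.integrableOn_Icc (by fun_prop))
  · exact (Continuous.integrableOn_Icc (by fun_prop))

end

section

variable {e : ℝ × ℝ → ℂ} {s t : ℂ →L[ℝ] ℝ} {v : ℂ}

/-- The closed coordinate rectangle. -/
def closedCoordRect (s t : ℂ →L[ℝ] ℝ) (a b : ℝ) : Set ℂ := {z | s z ∈ Icc 0 a ∧ t z ∈ Icc 0 b}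

theorem coordRect_subset_closed (s t : ℂ →L[ℝ] ℝ) (a b : ℝ) :
    coordRect s t a b ⊆ closedCoordRect s t a b :=
  fun _ hz => ⟨Ioo_subset_Icc_self hz.1, Ioo_subset_Icc_self hz.2⟩

theorem IsCoord.mem_closed (hc : IsCoord e s t v) {a b x y : ℝ} (hx : x ∈ Icc 0 a)
    (hy : y ∈ Icc 0 b) : e (x, y) ∈ closedCoordRect s t a b := by
  refine ⟨?_, ?_⟩
  · rwa [hc.fst]
  · rwa [hc.snd]

theorem integral_test (hc : IsCoord e s t v) {a b : ℝ} (ha : 0 < a) (hb : 0 ≤ b)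
    {g G : ℂ → ℂ} (hg : ContinuousOn g (closedCoordRect s t a b))
    (hw : HasWeakDeriv (coordRect s t a b) v g G)
    (hG : IntegrableOn G (coordRect s t a b)) {χ : ℝ → ℝ} (hχ : ContDiff ℝ ∞ χ)
    (hχc : HasCompactSupport χ) (hχs : tsupport χ ⊆ Ioo 0 b) :
    ∫ z in coordRect s t a b, χ (t z) • G z
      = ∫ y in Icc 0 b, χ y • (g (e (a, y)) - g (e (0, y))) := by
  -- Composition with the retraction onto the closed rectangle extends g continuously to the plane.
  let g' : ℂ → ℂ := fun z => g (e (projIcc 0 a ha.le (s z), projIcc 0 b hb (t z)))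
  have hg' : Continuous g' := by
    refine hg.comp_continuous ?_ fun z => hc.mem_closed (Subtype.coe_prop _) (Subtype.coe_prop _)
    have := hc.continuous
    exact this.comp ((continuous_subtype_val.comp (continuous_projIcc.comp s.continuous)).prodMk
      (continuous_subtype_val.comp (continuous_projIcc.comp t.continuous)))
  have heq : ∀ z ∈ closedCoordRect s t a b, g' z = g z := by
    intro z hz
    simp only [g']
    rw [projIcc_of_mem _ hz.1, projIcc_of_mem _ hz.2, hc.apply_coords]
  have hm := (isOpen_coordRect s t a b).measurableSet
  have h := integral_test_of_continuous hc ha hg'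
    (hw.congr_of_ae subset_rfl hm (by
      rw [ae_restrict_iff' hm]
      exact Eventually.of_forall fun z hz => heq z (coordRect_subset_closed s t a b hz))
      (Eventually.of_forall fun _ => rfl)) hG hχ hχc hχs
  rw [h]
  refine setIntegral_congr_fun measurableSet_Icc fun y hy => ?_
  rw [heq _ (hc.mem_closed (right_mem_Icc.2 ha.le) hy),
    heq _ (hc.mem_closed (left_mem_Icc.2 ha.le) hy)]

/-- Testing against smooth χ shows that almost every slice integral of `ℓ ∘ G` equals c. Once this
is known, the weight need only be bounded and measurable, which matters because the stretch factor
of the minimiser has no more regularity. -/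
theorem integral_weighted (hc : IsCoord e s t v) {a b : ℝ} (ha : 0 < a) (hb : 0 ≤ b)
    {g G : ℂ → ℂ} (hg : ContinuousOn g (closedCoordRect s t a b))
    (hw : HasWeakDeriv (coordRect s t a b) v g G)
    (hG : IntegrableOn G (coordRect s t a b)) (ℓ : ℂ →L[ℝ] ℝ) {c : ℝ}
    (hbd : ∀ y ∈ Icc 0 b, ℓ (g (e (a, y))) - ℓ (g (e (0, y))) = c)
    {w : ℝ → ℝ} (hwm : Measurable w) {M : ℝ} (hwM : ∀ y, |w y| ≤ M) :
    ∫ z in coordRect s t a b, w (t z) * ℓ (G z) = ∫ y in Ioo 0 b, w y * c := by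
  set Ω := coordRect s t a b with hΩ
  have hΩm : MeasurableSet Ω := (isOpen_coordRect s t a b).measurableSet
  let N : ℂ → ℝ := Ω.indicator fun z => ℓ (G z)
  have hN : Integrable N := (integrable_indicator_iff hΩm).2 (ℓ.integrable_comp hG)
  have hNe : Integrable (fun x : ℝ × ℝ => N (e x)) (volume.prod volume) :=
    (hc.measurePreserving.integrable_comp_emb hc.measurableEmbedding).2 hN
  let m : ℝ → ℝ := fun y => ∫ x, N (e (x, y))
  have hm : Integrable m := hNe.integral_prod_right
  have hfub : ∀ w : ℝ → ℝ, Measurable w → ∀ M, (∀ y, |w y| ≤ M) →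
      ∫ z in Ω, w (t z) * ℓ (G z) = ∫ y, w y * m y := by
    intro w hwm M hwM
    have hprod : Integrable (fun x : ℝ × ℝ => w x.2 * N (e x)) (volume.prod volume) := by
      refine hNe.bdd_mul (c := M) (hwm.comp measurable_snd).aestronglyMeasurable
        (Eventually.of_forall fun x => ?_)
      exact hwM _
    calc ∫ z in Ω, w (t z) * ℓ (G z) = ∫ z, w (t z) * N z := by
          rw [← integral_indicator hΩm]
          congr 1; ext1 z
          by_cases hz : z ∈ Ω <;> simp [N, hz]
      _ = ∫ x : ℝ × ℝ, w x.2 * N (e x) := by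
          rw [← hc.measurePreserving.integral_comp hc.measurableEmbedding]
          congr 1; ext1 x
          rw [← Prod.mk.eta (p := x), hc.snd]
      _ = ∫ y, ∫ x, w y * N (e (x, y)) := by
          rw [Measure.volume_eq_prod, integral_prod_symm _ hprod]
      _ = ∫ y, w y * m y := by
          congr 1; ext1 y; rw [integral_const_mul]
  -- Fundamental lemma of the calculus of variations, applied to the slice integral minus c.
  have hmc : ∀ᵐ y, y ∈ Ioo 0 b → m y - c = 0 := by
    refine isOpen_Ioo.ae_eq_zero_of_integral_contDiff_smul_eq_zero
      ((hm.locallyIntegrable.sub (locallyIntegrable_const c)).locallyIntegrableOn _)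
      fun χ hχ hχc hχs => ?_
    obtain ⟨C, hC⟩ := hχ.continuous.bounded_above_of_compact_support hχc
    have h1 := hfub χ hχ.continuous.measurable C hC
    have h2 := integral_test hc ha hb hg hw hG hχ hχc hχs
    have hχG : IntegrableOn (fun z => χ (t z) • G z) Ω :=
      hG.bdd_smul C (hχ.continuous.comp t.continuous).aestronglyMeasurable
        (Eventually.of_forall fun z => hC _)
    have hχI : Integrable χ := hχ.continuous.integrable_of_hasCompactSupport hχc
    have hχm : Integrable fun y => χ y * m y :=
      hm.bdd_mul hχ.continuous.aestronglyMeasurable (Eventually.of_forall hC)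
    have h3 : ∫ z in Ω, χ (t z) * ℓ (G z) = ℓ (∫ z in Ω, χ (t z) • G z) := by
      rw [← ContinuousLinearMap.integral_comp_comm _ hχG]
      simp only [map_smul, smul_eq_mul]
    have hcont : ∀ x ∈ Icc 0 a, ContinuousOn (fun y => g (e (x, y))) (Icc 0 b) := fun x hx =>
      hg.comp (hc.continuous.comp (by fun_prop)).continuousOn fun y hy => hc.mem_closed hx hy
    have h4 : ℓ (∫ y in Icc 0 b, χ y • (g (e (a, y)) - g (e (0, y)))) = ∫ y, χ y * c := by
      rw [← ContinuousLinearMap.integral_comp_comm]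
      · rw [← setIntegral_eq_integral_of_forall_compl_eq_zero (s := Icc 0 b)
          (f := fun y => χ y * c)]
        · refine setIntegral_congr_fun measurableSet_Icc fun y hy => ?_
          simp only [map_smul, map_sub, smul_eq_mul]
          rw [hbd y hy]
        · intro y hy
          rw [image_eq_zero_of_notMem_tsupport fun h => hy (Ioo_subset_Icc_self (hχs h)), zero_mul]
      · exact (hχ.continuous.continuousOn.smul ((hcont a (right_mem_Icc.2 ha.le)).sub
          (hcont 0 (left_mem_Icc.2 ha.le)))).integrableOn_Icc
    simp only [smul_eq_mul, mul_sub]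
    rw [integral_sub hχm (hχI.mul_const c), ← h1, h3, h2, h4, sub_self]
  rw [hfub w hwm M hwM, ← setIntegral_eq_integral_of_forall_compl_eq_zero (s := Ioo 0 b)]
  · refine setIntegral_congr_ae measurableSet_Ioo ?_
    filter_upwards [hmc] with y hy hyb
    rw [sub_eq_zero.1 (hy hyb)]
  · intro y hy
    have : m y = 0 := by
      simp only [m]
      rw [← integral_zero ℝ ℝ]
      congr 1; ext1 x
      refine indicator_of_notMem (fun h => hy ?_) _
      have := h.2
      rwa [hc.snd] at this
    rw [this, mul_zero]

/-- The boundary identity on the subrectangle of width x gives equality for almost every y, and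
continuity extends it to the closed interval. -/
theorem eq_of_weakDeriv_eq_zero (hc : IsCoord e s t v) {a b : ℝ} (hb : 0 < b)
    {d D : ℂ → ℂ} (hd : ContinuousOn d (closedCoordRect s t a b))
    (hw : HasWeakDeriv (coordRect s t a b) v d D)
    (hD : ∀ᵐ z ∂volume.restrict (coordRect s t a b), D z = 0) {x y : ℝ} (hx : x ∈ Icc 0 a)
    (hy : y ∈ Icc 0 b) : d (e (x, y)) = d (e (0, y)) := by
  rcases hx.1.eq_or_lt with rfl | hx0
  · rfl
  have hsub : coordRect s t x b ⊆ coordRect s t a b := fun z hz =>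
    ⟨⟨hz.1.1, hz.1.2.trans_le hx.2⟩, hz.2⟩
  have hsubc : closedCoordRect s t x b ⊆ closedCoordRect s t a b := fun z hz =>
    ⟨⟨hz.1.1, hz.1.2.trans hx.2⟩, hz.2⟩
  have hm := (isOpen_coordRect s t x b).measurableSet
  have hw0 : HasWeakDeriv (coordRect s t x b) v d fun _ => 0 := by
    refine hw.congr_of_ae hsub hm (Eventually.of_forall fun _ => rfl) ?_
    exact (ae_restrict_of_ae_restrict_of_subset hsub hD).mono fun _ h => h.symm
  have hcont : ∀ x' ∈ Icc 0 x, ContinuousOn (fun y => d (e (x', y))) (Icc 0 b) := fun x' hx' =>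
    (hd.mono hsubc).comp (hc.continuous.comp (by fun_prop)).continuousOn
      fun y hy => hc.mem_closed hx' hy
  have hc1 := hcont x (right_mem_Icc.2 hx0.le)
  have hc0 := hcont 0 (left_mem_Icc.2 hx0.le)
  have hae : ∀ᵐ y, y ∈ Ioo 0 b → d (e (x, y)) - d (e (0, y)) = 0 := by
    refine isOpen_Ioo.ae_eq_zero_of_integral_contDiff_smul_eq_zero
      (((hc1.sub hc0).mono Ioo_subset_Icc_self).locallyIntegrableOn measurableSet_Ioo)
      fun χ hχ hχc hχs => ?_
    have h := integral_test hc hx0 hb.le (hd.mono hsubc) hw0 (by simp) hχ hχc hχs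
    rw [← setIntegral_eq_integral_of_forall_compl_eq_zero (s := Icc 0 b), ← h]
    · simp
    · intro y hy
      rw [image_eq_zero_of_notMem_tsupport fun h => hy (Ioo_subset_Icc_self (hχs h)), zero_smul]
  refine Measure.eqOn_Icc_of_ae_eq volume hb.ne ?_ hc1 hc0 hy
  rw [← restrict_Ioo_eq_restrict_Icc]
  refine (ae_restrict_iff' measurableSet_Ioo).2 ?_
  filter_upwards [hae] with y h hyb using sub_eq_zero.1 (h hyb)

end

/-! ### The one-dimensional energy density and the Euler–Lagrange equation -/

/-- The energy density of the linear map `x + iy ↦ tx + iy`. -/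
noncomputable def density (p t : ℝ) : ℝ := ((t + t⁻¹) / 2) ^ p

/-- The derivative of `density p`. -/
noncomputable def slope (p t : ℝ) : ℝ := p * ((t + t⁻¹) / 2) ^ (p - 1) * ((1 - t⁻¹ ^ 2) / 2)

theorem one_le_half_add_inv {t : ℝ} (ht : 0 < t) : 1 ≤ (t + t⁻¹) / 2 := by
  have : (t + t⁻¹) / 2 - 1 = (t - 1) ^ 2 / (2 * t) := by field_simp; ring
  have h2 : 0 ≤ (t - 1) ^ 2 / (2 * t) := by positivity
  linarith

/-- The exact quadratic remainder is the source of strict convexity, and thus of uniqueness. -/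
theorem half_add_inv_sub {a t : ℝ} (ha : 0 < a) (ht : 0 < t) :
    (t + t⁻¹) / 2 - (a + a⁻¹) / 2 = (1 - a⁻¹ ^ 2) / 2 * (t - a) + (t - a) ^ 2 / (2 * a ^ 2 * t) := by
  field_simp
  ring

theorem rpow_tangent_le {x y p : ℝ} (hx : 0 < x) (hy : 0 < y) (hp : 1 < p) :
    x ^ p + p * x ^ (p - 1) * (y - x) ≤ y ^ p := by
  have h := one_add_mul_self_le_rpow_one_add (s := y / x - 1)
    (by have : 0 < y / x := by positivity
        linarith) hp.le
  rw [add_sub_cancel, Real.div_rpow hy.le hx.le, le_div_iff₀ (by positivity)] at h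
  refine le_trans (le_of_eq ?_) h
  rw [Real.rpow_sub_one hx.ne']
  field_simp

/-- The tangent inequality for the increasing convex power (Bernoulli) is composed with the exact
expansion of (t + 1/t)/2, whose remainder is positive. -/
theorem density_tangent_lt {p a t : ℝ} (hp : 1 < p) (ha : 0 < a) (ht : 0 < t) (hne : t ≠ a) :
    density p a + slope p a * (t - a) < density p t := by
  have ha1 := one_le_half_add_inv ha
  have ht1 := one_le_half_add_inv ht
  have h := rpow_tangent_le (x := (a + a⁻¹) / 2) (y := (t + t⁻¹) / 2) (by linarith) (by linarith) hp
  have hpos : 0 < p * ((a + a⁻¹) / 2) ^ (p - 1) := by positivity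
  have hsq : 0 < (t - a) ^ 2 / (2 * a ^ 2 * t) := by
    have := sq_pos_of_ne_zero (sub_ne_zero.2 hne)
    positivity
  rw [half_add_inv_sub ha ht] at h
  unfold density slope
  nlinarith [mul_pos hpos hsq]

theorem density_tangent_le {p a t : ℝ} (hp : 1 < p) (ha : 0 < a) (ht : 0 < t) :
    density p a + slope p a * (t - a) ≤ density p t := by
  rcases eq_or_ne t a with rfl | hne
  · simp
  · exact (density_tangent_lt hp ha ht hne).le

theorem density_inv (p t : ℝ) : density p t⁻¹ = density p t := by
  simp [density, add_comm]

theorem slope_inv {p t : ℝ} (ht : 0 < t) : slope p t⁻¹ = -(t ^ 2 * slope p t) := by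
  unfold slope
  rw [inv_inv, add_comm t⁻¹ t]
  field_simp
  ring

theorem density_one (p : ℝ) : density p 1 = 1 := by norm_num [density]

theorem slope_lt_slope {p a b : ℝ} (hp : 1 < p) (ha : 0 < a) (hab : a < b) :
    slope p a < slope p b := by
  have hb := ha.trans hab
  have h1 := density_tangent_lt hp ha hb hab.ne'
  have h2 := density_tangent_lt hp hb ha hab.ne
  have : slope p a * (b - a) < slope p b * (b - a) := by linarith
  exact lt_of_mul_lt_mul_right this (by linarith)

theorem continuous_slope_exp {p : ℝ} (hp : 1 < p) : Continuous fun s => slope p (Real.exp s) := by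
  unfold slope
  have : ∀ s, Real.exp s ≠ 0 := fun s => (Real.exp_pos s).ne'
  have h1 : Continuous fun s : ℝ => (Real.exp s)⁻¹ := Real.continuous_exp.inv₀ this
  have h2 : Continuous fun s : ℝ => ((Real.exp s + (Real.exp s)⁻¹) / 2) ^ (p - 1) :=
    ((Real.continuous_exp.add h1).div_const 2).rpow_const fun s => Or.inr (by linarith)
  fun_prop

/-- This is where p > 1 is essential: the factor with exponent p - 1 drives the slope to +∞, whereas
for p = 1 the slope stays below 1/2. The exponential parametrisation makes the slope an order
isomorphism of ℝ, so continuity of its inverse is automatic. -/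
theorem surjective_slope_exp {p : ℝ} (hp : 1 < p) :
    Function.Surjective fun s => slope p (Real.exp s) := by
  refine (continuous_slope_exp hp).surjective ?_ ?_
  · have h1 : Tendsto (fun s : ℝ => p * (3 / 8) * (Real.exp s / 2) ^ (p - 1)) atTop atTop := by
      refine Tendsto.const_mul_atTop (by positivity) ?_
      exact (tendsto_rpow_atTop (by linarith)).comp
        (Real.tendsto_exp_atTop.atTop_div_const (by norm_num))
    refine tendsto_atTop_mono' _ ?_ h1
    filter_upwards [Real.tendsto_exp_atTop.eventually_ge_atTop 2] with s hs
    have hpos := Real.exp_pos s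
    have hinv : (Real.exp s)⁻¹ ≤ 1 / 2 := by
      rw [inv_le_comm₀ hpos (by norm_num)]; simpa using hs
    have hinv0 : 0 < (Real.exp s)⁻¹ := by positivity
    have h2 : (Real.exp s / 2) ^ (p - 1) ≤ ((Real.exp s + (Real.exp s)⁻¹) / 2) ^ (p - 1) :=
      Real.rpow_le_rpow (by positivity) (by linarith) (by linarith)
    -- Since exp s ≥ 2, the last factor of the slope is at least (1 - 1/4)/2.
    have h3 : 3 / 8 ≤ (1 - (Real.exp s)⁻¹ ^ 2) / 2 := by nlinarith
    unfold slope
    calc p * (3 / 8) * (Real.exp s / 2) ^ (p - 1)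
        = p * (Real.exp s / 2) ^ (p - 1) * (3 / 8) := by ring
      _ ≤ _ := by gcongr
  · have hexp : Tendsto (fun s : ℝ => (Real.exp s)⁻¹) atBot atTop := by
      simp_rw [← Real.exp_neg]
      exact Real.tendsto_exp_atTop.comp tendsto_neg_atBot_atTop
    have h1 : Tendsto (fun s : ℝ => p / 2 * (1 - (Real.exp s)⁻¹)) atBot atBot := by
      refine Tendsto.const_mul_atBot (by positivity) ?_
      simp_rw [sub_eq_add_neg]
      exact tendsto_atBot_add_const_left _ _ (tendsto_neg_atTop_atBot.comp hexp)
    refine tendsto_atBot_mono' _ ?_ h1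
    filter_upwards [hexp.eventually_ge_atTop 1] with s hs
    have hpos := Real.exp_pos s
    have h2 : 1 ≤ ((Real.exp s + (Real.exp s)⁻¹) / 2) ^ (p - 1) :=
      Real.one_le_rpow (one_le_half_add_inv hpos) (by linarith)
    unfold slope
    have h3 : (1 - (Real.exp s)⁻¹ ^ 2) / 2 ≤ (1 - (Real.exp s)⁻¹) / 2 := by nlinarith
    have h4 : (1 - (Real.exp s)⁻¹) / 2 ≤ 0 := by linarith
    nlinarith [mul_nonneg (by linarith : 0 ≤ p) (sub_nonneg.2 h2),
      mul_nonneg (mul_nonneg (by linarith : 0 ≤ p) (by linarith : 0 ≤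
        ((Real.exp s + (Real.exp s)⁻¹) / 2) ^ (p - 1))) (sub_nonneg.2 h3),
      mul_nonneg (mul_nonneg (by linarith : 0 ≤ p) (sub_nonneg.2 h2)) (neg_nonneg.2 h4)]

/-- The order isomorphism `s ↦ slope p (exp s)` of the line. -/
noncomputable def slopeIso {p : ℝ} (hp : 1 < p) : ℝ ≃o ℝ :=
  StrictMono.orderIsoOfSurjective (fun s => slope p (Real.exp s))
    (fun _ _ h => slope_lt_slope hp (Real.exp_pos _) (Real.exp_lt_exp.2 h))
    (surjective_slope_exp hp)

/-- The solution of `slope p t = y`. -/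
noncomputable def slopeInv {p : ℝ} (hp : 1 < p) (y : ℝ) : ℝ := Real.exp ((slopeIso hp).symm y)

theorem slopeInv_pos {p : ℝ} (hp : 1 < p) (y : ℝ) : 0 < slopeInv hp y := Real.exp_pos _

theorem slope_slopeInv {p : ℝ} (hp : 1 < p) (y : ℝ) : slope p (slopeInv hp y) = y :=
  (slopeIso hp).apply_symm_apply y

theorem slopeInv_slope {p t : ℝ} (hp : 1 < p) (ht : 0 < t) : slopeInv hp (slope p t) = t := by
  have := (slopeIso hp).symm_apply_apply (Real.log t)
  rw [slopeInv]
  change (slopeIso hp).symm (slope p (Real.exp (Real.log t))) = _ at this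
  rw [Real.exp_log ht] at this
  rw [this, Real.exp_log ht]

theorem continuous_slopeInv {p : ℝ} (hp : 1 < p) : Continuous (slopeInv hp) :=
  Real.continuous_exp.comp (slopeIso hp).symm.continuous

theorem slopeInv_mono {p : ℝ} (hp : 1 < p) : Monotone (slopeInv hp) :=
  fun _ _ h => Real.exp_le_exp.2 ((slopeIso hp).symm.monotone h)

/-- The stretch factor is `slopeInv hp (α / w x)`. Its integral depends continuously on α, so the
intermediate value theorem finds the α that gives length L. -/
theorem exists_stretch {l L p c C : ℝ} (hl : 0 < l) (hL : 0 < L) (hp : 1 < p) (hc : 0 < c)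
    {w : ℝ → ℝ} (hw : Measurable w) (hcw : ∀ x, c ≤ w x) (hwC : ∀ x, w x ≤ C) :
    ∃ (α : ℝ) (a : ℝ → ℝ) (m M : ℝ), 0 < m ∧ Measurable a ∧ (∀ x, m ≤ a x) ∧ (∀ x, a x ≤ M) ∧
      (∀ x, w x * slope p (a x) = α) ∧ ∫ x in (0 : ℝ)..l, a x = L := by
  have hw0 : ∀ x, 0 < w x := fun x => hc.trans_le (hcw x)
  have hC : 0 < C := (hw0 0).trans_le (hwC 0)
  have habs : ∀ {R α : ℝ}, |α| ≤ R → ∀ x, -(R / c) ≤ α / w x ∧ α / w x ≤ R / c := by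
    intro R α hα x
    rw [← abs_le, abs_div, abs_of_pos (hw0 x)]
    exact div_le_div₀ ((abs_nonneg _).trans hα) hα hc (hcw x)
  have hmeas : ∀ α : ℝ, Measurable fun x => slopeInv hp (α / w x) := fun α =>
    (continuous_slopeInv hp).measurable.comp (measurable_const.div hw)
  let I : ℝ → ℝ := fun α => ∫ x in (0 : ℝ)..l, slopeInv hp (α / w x)
  have hint : ∀ α, IntervalIntegrable (fun x => slopeInv hp (α / w x)) volume 0 l := by
    intro α
    refine IntervalIntegrable.mono_fun' (g := fun _ => slopeInv hp (|α| / c))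
      intervalIntegrable_const (hmeas α).aestronglyMeasurable (Eventually.of_forall fun x => ?_)
    beta_reduce
    rw [Real.norm_of_nonneg (slopeInv_pos hp _).le]
    exact slopeInv_mono hp (habs le_rfl x).2
  have hI : Continuous I := by
    rw [continuous_iff_continuousAt]
    intro α₀
    refine intervalIntegral.continuousAt_of_dominated_interval
      (bound := fun _ => slopeInv hp ((|α₀| + 1) / c)) (Eventually.of_forall fun α =>
        (hmeas α).aestronglyMeasurable) ?_ intervalIntegrable_const ?_
    · filter_upwards [Metric.ball_mem_nhds α₀ one_pos] with α hα
      refine Eventually.of_forall fun x _ => ?_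
      rw [Real.norm_of_nonneg (slopeInv_pos hp _).le]
      refine slopeInv_mono hp (habs ?_ x).2
      rw [Metric.mem_ball, Real.dist_eq] at hα
      have := abs_sub_abs_le_abs_sub α α₀
      linarith
    · refine Eventually.of_forall fun x _ => ?_
      have := continuous_slopeInv hp
      fun_prop
  have hconst : ∀ k : ℝ, ∫ _ in (0 : ℝ)..l, k = l * k := by simp
  set y := slope p (L / l) with hy
  have hy' : slopeInv hp y = L / l := slopeInv_slope hp (by positivity)
  -- With α = C max(y, 0) and w ≤ C, the quotient α / w is at least y, so the stretch factor is at
  -- least L / l everywhere. The choice C min(y, 0) below gives the opposite bound.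
  have hhi : L ≤ I (C * max y 0) := by
    have : ∫ _ in (0 : ℝ)..l, L / l ≤ I (C * max y 0) := by
      refine intervalIntegral.integral_mono_on hl.le intervalIntegrable_const (hint _)
        fun x _ => ?_
      rw [← hy']
      refine slopeInv_mono hp ((le_max_left y 0).trans ?_)
      rw [le_div_iff₀ (hw0 x), mul_comm]
      exact mul_le_mul_of_nonneg_right (hwC x) (le_max_right _ _)
    rwa [hconst, mul_div_cancel₀ _ hl.ne'] at this
  have hlo : I (C * min y 0) ≤ L := by
    have : I (C * min y 0) ≤ ∫ _ in (0 : ℝ)..l, L / l := by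
      refine intervalIntegral.integral_mono_on hl.le (hint _) intervalIntegrable_const
        fun x _ => ?_
      rw [← hy']
      refine slopeInv_mono hp (le_trans ?_ (min_le_left y 0))
      rw [div_le_iff₀ (hw0 x), mul_comm]
      exact mul_le_mul_of_nonpos_left (hwC x) (min_le_right _ _)
    rwa [hconst, mul_div_cancel₀ _ hl.ne'] at this
  obtain ⟨α, hα⟩ := mem_range_of_exists_le_of_exists_ge hI ⟨_, hlo⟩ ⟨_, hhi⟩
  refine ⟨α, fun x => slopeInv hp (α / w x), slopeInv hp (-(|α| / c)), slopeInv hp (|α| / c),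
    slopeInv_pos hp _, hmeas α, fun x => slopeInv_mono hp (habs le_rfl x).1,
    fun x => slopeInv_mono hp (habs le_rfl x).2, fun x => ?_, hα⟩
  rw [slope_slopeInv, mul_div_cancel₀ _ (hw0 x).ne']

/-! ### Horizontal stretches as admissible mappings -/

section

theorem ae_re {P : ℝ → Prop} (h : ∀ᵐ x, P x) : ∀ᵐ z : ℂ, P z.re :=
  (Measure.quasiMeasurePreserving_fst.comp
    Complex.volume_preserving_equiv_real_prod.quasiMeasurePreserving).ae h

theorem integral_smul_of_lipschitz {h k : ℂ → ℝ} {C : NNReal} (hh : LipschitzWith C h) {v : ℂ}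
    (hk : ∀ᵐ z, lineDeriv ℝ h z v = k z) {φ : ℂ → ℝ} (hφ : ContDiff ℝ ∞ φ)
    (hc : HasCompactSupport φ) : ∫ z, φ z * k z = - ∫ z, fderiv ℝ φ z v * h z := by
  obtain ⟨D, hD⟩ := (hφ.of_le (by simp) : ContDiff ℝ 1 φ).lipschitzWith_of_hasCompactSupport hc (by simp)
  have e := hh.integral_lineDeriv_mul_eq (μ := volume) hD hc v
  have e1 : ∫ z, φ z * k z = ∫ z, lineDeriv ℝ h z v * φ z := by
    apply integral_congr_ae
    filter_upwards [hk] with z hz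
    rw [hz, mul_comm]
  rw [e1, e, ← integral_neg]
  congr 1; ext1 z
  rw [(hφ.differentiable (by simp) z).lineDeriv_eq_fderiv, map_neg, neg_mul]

theorem hasWeakDeriv_of_lipschitz (Ω : Set ℂ) {h₁ h₂ k₁ k₂ : ℂ → ℝ} {C₁ C₂ : NNReal}
    (hh₁ : LipschitzWith C₁ h₁) (hh₂ : LipschitzWith C₂ h₂) {v : ℂ}
    (hk₁ : ∀ᵐ z, lineDeriv ℝ h₁ z v = k₁ z) (hk₂ : ∀ᵐ z, lineDeriv ℝ h₂ z v = k₂ z)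
    (hl₁ : LocallyIntegrable k₁) (hl₂ : LocallyIntegrable k₂) :
    HasWeakDeriv Ω v (fun z => h₁ z + h₂ z * I) fun z => k₁ z + k₂ z * I := by
  have hloc : ∀ {k₁ k₂ : ℂ → ℝ}, LocallyIntegrable k₁ → LocallyIntegrable k₂ →
      LocallyIntegrable fun z => (k₁ z : ℂ) + k₂ z * I := by
    intro k₁ k₂ h1 h2 z
    obtain ⟨s, hs, i1⟩ := h1 z
    obtain ⟨s', hs', i2⟩ := h2 z
    refine ⟨s ∩ s', inter_mem hs hs', ?_⟩
    exact (Integrable.ofReal (i1.mono_set inter_subset_left)).add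
      ((Integrable.ofReal (i2.mono_set inter_subset_right)).mul_const I)
  have split : ∀ {ψ : ℂ → ℝ} {k₁ k₂ : ℂ → ℝ}, Continuous ψ → HasCompactSupport ψ →
      LocallyIntegrable k₁ → LocallyIntegrable k₂ →
      ∫ z, ψ z • ((k₁ z : ℂ) + k₂ z * I)
        = ((∫ z, ψ z * k₁ z : ℝ) : ℂ) + ((∫ z, ψ z * k₂ z : ℝ) : ℂ) * I := by
    intro ψ k₁ k₂ hψ hψc h1 h2
    have i1 : Integrable fun z => ψ z * k₁ z := h1.integrable_smul_left_of_hasCompactSupport hψ hψc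
    have i2 : Integrable fun z => ψ z * k₂ z := h2.integrable_smul_left_of_hasCompactSupport hψ hψc
    rw [← integral_complex_ofReal, ← integral_complex_ofReal, ← integral_mul_const, ← integral_add]
    · congr 1; ext1 z
      simp only [real_smul]
      push_cast
      ring
    · exact i1.ofReal
    · exact i2.ofReal.mul_const I
  have hc1 := hh₁.continuous.locallyIntegrable (μ := volume)
  have hc2 := hh₂.continuous.locallyIntegrable (μ := volume)
  refine ⟨(hloc hc1 hc2).locallyIntegrableOn _, (hloc hl₁ hl₂).locallyIntegrableOn _,
    fun φ hφ hc _ => ?_⟩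
  have hdc : Continuous fun z => fderiv ℝ φ z v :=
    (hφ.continuous_fderiv (by simp)).clm_apply continuous_const
  have hdcs : HasCompactSupport fun z => fderiv ℝ φ z v := hc.fderiv_apply ℝ v
  rw [split hφ.continuous hc hl₁ hl₂, split hdc hdcs hc1 hc2,
    integral_smul_of_lipschitz hh₁ hk₁ hφ hc, integral_smul_of_lipschitz hh₂ hk₂ hφ hc]
  push_cast
  ring

variable {a : ℝ → ℝ} {m M : ℝ}

theorem intervalIntegrable_of_bounds (ha : Measurable a) (hm : ∀ x, m ≤ a x) (hM : ∀ x, a x ≤ M)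
    (x y : ℝ) : IntervalIntegrable a volume x y := by
  refine IntervalIntegrable.mono_fun' (g := fun _ => max |m| |M|)
    intervalIntegrable_const ha.aestronglyMeasurable (Eventually.of_forall fun x => ?_)
  exact abs_le_max_abs_abs (hm x) (hM x)

/-- The primitive of `a`. -/
noncomputable def primitive (a : ℝ → ℝ) (x : ℝ) : ℝ := ∫ t in (0 : ℝ)..x, a t

theorem primitive_sub_bounds (ha : Measurable a) (hm : ∀ x, m ≤ a x) (hM : ∀ x, a x ≤ M)
    {x y : ℝ} (hxy : x ≤ y) :
    m * (y - x) ≤ primitive a y - primitive a x ∧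
      primitive a y - primitive a x ≤ M * (y - x) := by
  have hint := intervalIntegrable_of_bounds ha hm hM
  have e : primitive a y - primitive a x = ∫ t in x..y, a t :=
    intervalIntegral.integral_interval_sub_left (hint _ _) (hint _ _)
  have hconst : ∀ k : ℝ, ∫ _ in x..y, k = k * (y - x) := by simp [mul_comm]
  rw [e, ← hconst m, ← hconst M]
  exact ⟨intervalIntegral.integral_mono_on hxy intervalIntegrable_const (hint _ _) fun t _ => hm t,
    intervalIntegral.integral_mono_on hxy (hint _ _) intervalIntegrable_const fun t _ => hM t⟩

theorem strictMono_primitive (ha : Measurable a) (hm0 : 0 < m) (hm : ∀ x, m ≤ a x)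
    (hM : ∀ x, a x ≤ M) : StrictMono (primitive a) := fun x y hxy => by
  have := (primitive_sub_bounds ha hm hM hxy.le).1
  nlinarith [mul_pos hm0 (sub_pos.2 hxy)]

theorem lipschitz_primitive (ha : Measurable a) (hm0 : 0 < m) (hm : ∀ x, m ≤ a x)
    (hM : ∀ x, a x ≤ M) : LipschitzWith M.toNNReal (primitive a) := by
  have hM0 : 0 ≤ M := hm0.le.trans ((hm 0).trans (hM 0))
  refine LipschitzWith.of_dist_le_mul fun x y => ?_
  rw [Real.coe_toNNReal _ hM0]
  wlog hxy : x ≤ y generalizing x y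
  · rw [dist_comm, dist_comm x]; exact this y x (le_of_not_ge hxy)
  have h := primitive_sub_bounds ha hm hM hxy
  have h0 : 0 ≤ m * (y - x) := mul_nonneg hm0.le (sub_nonneg.2 hxy)
  rw [dist_comm, dist_comm x, Real.dist_eq, Real.dist_eq, abs_of_nonneg (h0.trans h.1),
    abs_of_nonneg (sub_nonneg.2 hxy)]
  exact h.2

/-- The map `x + iy ↦ u(x) + iy`, where `u` is the primitive of `a`. -/
noncomputable def stretch (a : ℝ → ℝ) (z : ℂ) : ℂ := (primitive a z.re : ℂ) + (z.im : ℂ) * I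

theorem lipschitz_re : LipschitzWith 1 Complex.re := by
  refine LipschitzWith.of_dist_le_mul fun z w => ?_
  rw [Real.dist_eq, NNReal.coe_one, one_mul, dist_eq_norm, ← Complex.sub_re]
  exact abs_re_le_norm _

theorem lipschitz_im : LipschitzWith 1 Complex.im := by
  refine LipschitzWith.of_dist_le_mul fun z w => ?_
  rw [Real.dist_eq, NNReal.coe_one, one_mul, dist_eq_norm, ← Complex.sub_im]
  exact abs_im_le_norm _

theorem locallyIntegrable_of_bounds (ha : Measurable a) (hm : ∀ x, m ≤ a x) (hM : ∀ x, a x ≤ M) :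
    LocallyIntegrable fun z : ℂ => a z.re := by
  refine (locallyIntegrable_const (max |m| |M|)).mono
    (ha.comp Complex.measurable_re).aestronglyMeasurable (Eventually.of_forall fun z => ?_)
  exact (abs_le_max_abs_abs (hm z.re) (hM z.re)).trans (le_abs_self _)

theorem hasWeakDeriv_stretch_one (Ω : Set ℂ) (ha : Measurable a) (hm0 : 0 < m)
    (hm : ∀ x, m ≤ a x) (hM : ∀ x, a x ≤ M) :
    HasWeakDeriv Ω 1 (stretch a) fun z => (a z.re : ℂ) := by
  have hloc : LocallyIntegrable a := by
    refine (locallyIntegrable_const (max |m| |M|)).mono ha.aestronglyMeasurable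
      (Eventually.of_forall fun z => ?_)
    exact (abs_le_max_abs_abs (hm z) (hM z)).trans (le_abs_self _)
  have h := hasWeakDeriv_of_lipschitz Ω (v := 1) (k₁ := fun z => a z.re) (k₂ := fun _ => 0)
    ((lipschitz_primitive ha hm0 hm hM).comp lipschitz_re) lipschitz_im ?_ ?_
    (locallyIntegrable_of_bounds ha hm hM) (locallyIntegrable_const _)
  · have e : stretch a = fun z => (primitive a z.re : ℂ) + (z.im : ℂ) * I := rfl
    rw [e]
    simpa using h
  · filter_upwards [ae_re (_root_.LocallyIntegrable.ae_hasDerivAt_integral hloc)] with z hz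
    refine HasLineDerivAt.lineDeriv ?_
    have h2 : HasDerivAt (fun t : ℝ => z.re + t) 1 0 := by
      simpa using (hasDerivAt_id (0 : ℝ)).const_add z.re
    have h3 : HasDerivAt (primitive a) (a z.re) (z.re + 0) := by rw [add_zero]; exact hz 0
    have := h3.comp (0 : ℝ) h2
    simpa [HasLineDerivAt, Function.comp_def] using this
  · refine Eventually.of_forall fun z => HasLineDerivAt.lineDeriv ?_
    simpa [HasLineDerivAt] using hasDerivAt_const (0 : ℝ) z.im

theorem hasWeakDeriv_stretch_I (Ω : Set ℂ) (ha : Measurable a) (hm0 : 0 < m)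
    (hm : ∀ x, m ≤ a x) (hM : ∀ x, a x ≤ M) :
    HasWeakDeriv Ω I (stretch a) fun _ => I := by
  have h := hasWeakDeriv_of_lipschitz Ω (v := I) (k₁ := fun z => 0) (k₂ := fun _ => 1)
    ((lipschitz_primitive ha hm0 hm hM).comp lipschitz_re) lipschitz_im ?_ ?_
    (locallyIntegrable_const _) (locallyIntegrable_const _)
  · have e : stretch a = fun z => (primitive a z.re : ℂ) + (z.im : ℂ) * I := rfl
    rw [e]
    simpa using h
  · refine Eventually.of_forall fun z => HasLineDerivAt.lineDeriv ?_
    simpa [HasLineDerivAt] using hasDerivAt_const (0 : ℝ) (primitive a z.re)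
  · refine Eventually.of_forall fun z => HasLineDerivAt.lineDeriv ?_
    simpa [HasLineDerivAt] using (hasDerivAt_id (0 : ℝ)).const_add z.im

theorem integrable_test_smul {Ω : Set ℂ} {g : ℂ → ℂ} {φ : ℂ → ℝ} (hg : LocallyIntegrableOn g Ω)
    (hφ : Continuous φ) (hc : HasCompactSupport φ) (hs : tsupport φ ⊆ Ω) :
    Integrable fun z => φ z • g z := by
  refine (integrableOn_iff_integrable_of_support_subset (s := tsupport φ) ?_).1 ?_
  · exact (Function.support_smul_subset_left _ _).trans (subset_tsupport φ)
  · obtain ⟨C, hC⟩ := hφ.bounded_above_of_compact_support hc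
    exact (hg.integrableOn_compact_subset hs hc).bdd_smul C hφ.aestronglyMeasurable
      (Eventually.of_forall hC)

theorem HasWeakDeriv.sub {Ω : Set ℂ} {v : ℂ} {f g p q : ℂ → ℂ} (hf : HasWeakDeriv Ω v f p)
    (hg : HasWeakDeriv Ω v g q) :
    HasWeakDeriv Ω v (fun z => f z - g z) fun z => p z - q z := by
  refine ⟨hf.locallyIntegrable.sub hg.locallyIntegrable,
    hf.locallyIntegrable_deriv.sub hg.locallyIntegrable_deriv, fun φ hφ hc hs => ?_⟩
  have hdc : Continuous fun z => fderiv ℝ φ z v :=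
    (hφ.continuous_fderiv (by simp)).clm_apply continuous_const
  have hds : tsupport (fun z => fderiv ℝ φ z v) ⊆ Ω := (tsupport_fderiv_apply_subset ℝ v).trans hs
  have hdcs : HasCompactSupport fun z => fderiv ℝ φ z v := hc.fderiv_apply ℝ v
  simp only [smul_sub]
  rw [integral_sub (integrable_test_smul hf.locallyIntegrable_deriv hφ.continuous hc hs)
    (integrable_test_smul hg.locallyIntegrable_deriv hφ.continuous hc hs),
    integral_sub (integrable_test_smul hf.locallyIntegrable hdc hdcs hds)
    (integrable_test_smul hg.locallyIntegrable hdc hdcs hds), hf.integral_eq φ hφ hc hs,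
    hg.integral_eq φ hφ hc hs]
  ring

/-- Makes the choice in `weakDeriv` harmless: any explicit weak derivative may be used almost
everywhere. -/
theorem ae_eq_of_hasWeakDeriv {Ω : Set ℂ} (hΩ : IsOpen Ω) {v : ℂ} {f g g' : ℂ → ℂ}
    (h : HasWeakDeriv Ω v f g) (h' : HasWeakDeriv Ω v f g') :
    ∀ᵐ z ∂volume.restrict Ω, g z = g' z := by
  rw [ae_restrict_iff' hΩ.measurableSet]
  have hd := h.sub h'
  simp only [sub_self] at hd
  have := hΩ.ae_eq_zero_of_integral_contDiff_smul_eq_zero hd.locallyIntegrable_deriv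
    fun φ hφ hc hs => by rw [hd.integral_eq φ hφ hc hs]; simp
  filter_upwards [this] with z hz hzΩ using sub_eq_zero.1 (hz hzΩ)

theorem hasWeakDeriv_weakDeriv {Ω : Set ℂ} {v : ℂ} {f : ℂ → ℂ} (h : ∃ g, HasWeakDeriv Ω v f g) :
    HasWeakDeriv Ω v f (weakDeriv Ω v f) := by
  rw [weakDeriv, dif_pos h]
  exact h.choose_spec

theorem isOpen_openRect (l : ℝ) : IsOpen (openRect l) := isOpen_Ioo.reProdIm isOpen_Ioo

theorem ae_weakDeriv_stretch (l : ℝ) (ha : Measurable a) (hm0 : 0 < m)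
    (hm : ∀ x, m ≤ a x) (hM : ∀ x, a x ≤ M) :
    ∀ᵐ z ∂volume.restrict (openRect l), weakDeriv (openRect l) 1 (stretch a) z = a z.re ∧
      weakDeriv (openRect l) I (stretch a) z = I := by
  have h1 := hasWeakDeriv_stretch_one (openRect l) ha hm0 hm hM
  have h2 := hasWeakDeriv_stretch_I (openRect l) ha hm0 hm hM
  filter_upwards [ae_eq_of_hasWeakDeriv (isOpen_openRect l) (hasWeakDeriv_weakDeriv ⟨_, h1⟩) h1,
    ae_eq_of_hasWeakDeriv (isOpen_openRect l) (hasWeakDeriv_weakDeriv ⟨_, h2⟩) h2] with z e1 e2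
  exact ⟨e1, e2⟩

theorem ae_distortion_stretch (l : ℝ) (ha : Measurable a) (hm0 : 0 < m)
    (hm : ∀ x, m ≤ a x) (hM : ∀ x, a x ≤ M) :
    ∀ᵐ z ∂volume.restrict (openRect l), jacobian (openRect l) (stretch a) z = a z.re ∧
      normSqDeriv (openRect l) (stretch a) z = a z.re ^ 2 + 1 ∧
      distortion (openRect l) (stretch a) z = (a z.re + (a z.re)⁻¹) / 2 := by
  filter_upwards [ae_weakDeriv_stretch l ha hm0 hm hM] with z ⟨h1, h2⟩
  have hpos : 0 < a z.re := hm0.trans_le (hm _)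
  have hj : jacobian (openRect l) (stretch a) z = a z.re := by
    rw [jacobian, h1, h2]; simp
  have hn : normSqDeriv (openRect l) (stretch a) z = a z.re ^ 2 + 1 := by
    rw [normSqDeriv, h1, h2]; simp
  refine ⟨hj, hn, ?_⟩
  rw [distortion, hj, hn, if_pos hpos]
  field_simp

theorem mem_rect {l : ℝ} {z : ℂ} : z ∈ rect l ↔ z.re ∈ Icc 0 l ∧ z.im ∈ Icc 0 1 := mem_reProdIm

theorem admissible_stretch {l L : ℝ} (hl : 0 < l) (ha : Measurable a) (hm0 : 0 < m)
    (hm : ∀ x, m ≤ a x) (hM : ∀ x, a x ≤ M) (hL : ∫ x in (0 : ℝ)..l, a x = L) :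
    Admissible l L (stretch a) := by
  have h0 : primitive a 0 = 0 := by simp [primitive]
  have hl' : primitive a l = L := hL
  have hmono := strictMono_primitive ha hm0 hm hM
  have hcont : Continuous (primitive a) := (lipschitz_primitive ha hm0 hm hM).continuous
  refine ⟨?_, ⟨?_, ?_, ?_⟩, ⟨⟨⟨_, hasWeakDeriv_stretch_one _ ha hm0 hm hM⟩,
    ⟨_, hasWeakDeriv_stretch_I _ ha hm0 hm hM⟩⟩, ?_, ?_⟩, ?_, ?_, ?_, ?_⟩
  · unfold stretch
    exact Continuous.continuousOn (by fun_prop)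
  · intro z hz
    rw [mem_rect] at hz ⊢
    simp only [stretch, add_re, ofReal_re, mul_re, I_re, ofReal_im, I_im, add_im, mul_im]
    refine ⟨⟨?_, ?_⟩, ?_⟩
    · have := hmono.monotone hz.1.1
      rw [h0] at this; simpa using this
    · have := hmono.monotone hz.1.2
      rw [hl'] at this; simpa using this
    · simpa using hz.2
  · intro z _ w _ h
    have h1 := congrArg Complex.re h
    have h2 := congrArg Complex.im h
    simp [stretch] at h1 h2
    exact Complex.ext (hmono.injective h1) h2
  · intro w hw
    rw [mem_rect] at hw
    have : w.re ∈ primitive a '' Icc 0 l := by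
      refine intermediate_value_Icc hl.le hcont.continuousOn ?_
      rw [h0, hl']; exact hw.1
    obtain ⟨x, hx, hxw⟩ := this
    refine ⟨x + w.im * I, ?_, ?_⟩
    · rw [mem_rect]; simpa using ⟨hx, hw.2⟩
    · simp [stretch, hxw, Complex.re_add_im]
  · filter_upwards [ae_distortion_stretch l ha hm0 hm hM] with z hz
    rw [hz.1]; exact hm0.le.trans (hm _)
  · refine ⟨fun z => (a z.re ^ 2 + 1) / a z.re, ?_⟩
    filter_upwards [ae_distortion_stretch l ha hm0 hm hM] with z hz
    rw [hz.1, hz.2.1, div_mul_cancel₀ _ (hm0.trans_le (hm _)).ne']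
  · intro y _; simp [stretch, h0]
  · intro y _; simp [stretch, hl']
  · intro x _; simp [stretch]
  · intro x _; simp [stretch]

end

/-! ### Pointwise calibration inequalities and their equality cases -/

section

section Pointwise

variable {p q : ℂ} {J r a w α : ℝ}

theorem norm_sq_eq_re_im (z : ℂ) : ‖z‖ ^ 2 = z.re ^ 2 + z.im ^ 2 := by
  rw [← Complex.normSq_eq_norm_sq, Complex.normSq_apply]; ring

theorem sq_jacobian_le (hJ : J = p.re * q.im - p.im * q.re) : J ^ 2 ≤ ‖p‖ ^ 2 * ‖q‖ ^ 2 := by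
  rw [norm_sq_eq_re_im, norm_sq_eq_re_im, hJ]
  nlinarith [sq_nonneg (p.re * q.re + p.im * q.im)]

theorem norm_sq_pos (hJ : J = p.re * q.im - p.im * q.re) (h0 : 0 < J) :
    0 < ‖p‖ ^ 2 ∧ 0 < ‖q‖ ^ 2 := by
  have h := sq_jacobian_le hJ
  have hJ2 : 0 < J ^ 2 := by positivity
  constructor
  · by_contra hc
    rw [le_antisymm (not_lt.1 hc) (sq_nonneg _), zero_mul] at h
    linarith
  · by_contra hc
    rw [le_antisymm (not_lt.1 hc) (sq_nonneg _), mul_zero] at h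
    linarith

/-- Since J ≤ |p||q|, each of |p|²/J and |q|²/J is at least the inverse of the other, while the
distortion is their mean. -/
theorem density_le_of_jacobian_pos (hr : 1 < r) (hJ : J = p.re * q.im - p.im * q.re)
    (h0 : 0 < J) :
    density r (‖p‖ ^ 2 / J) ≤ ((‖p‖ ^ 2 + ‖q‖ ^ 2) / (2 * J)) ^ r ∧
      density r (‖q‖ ^ 2 / J) ≤ ((‖p‖ ^ 2 + ‖q‖ ^ 2) / (2 * J)) ^ r := by
  obtain ⟨hp, hq⟩ := norm_sq_pos hJ h0
  have h := sq_jacobian_le hJ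
  set P := ‖p‖ ^ 2
  set Q := ‖q‖ ^ 2
  have hPQ : (P / J)⁻¹ ≤ Q / J := by
    rw [inv_div, div_le_div_iff₀ hp h0]; nlinarith
  have hQP : (Q / J)⁻¹ ≤ P / J := by
    rw [inv_div, div_le_div_iff₀ hq h0]; nlinarith
  have e : (P + Q) / (2 * J) = (P / J + Q / J) / 2 := by field_simp
  rw [e]
  constructor
  · exact Real.rpow_le_rpow (by positivity) (by linarith) (by linarith)
  · exact Real.rpow_le_rpow (by positivity) (by linarith) (by linarith)

theorem one_le_distortion (hJ : J = p.re * q.im - p.im * q.re) (h0 : 0 < J) :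
    1 ≤ (‖p‖ ^ 2 + ‖q‖ ^ 2) / (2 * J) := by
  rw [one_le_div (by positivity), norm_sq_eq_re_im, norm_sq_eq_re_im, hJ]
  nlinarith [sq_nonneg (p.re - q.im), sq_nonneg (p.im + q.re)]

theorem two_mul_re_sub_le (h0 : 0 < J) : 2 * p.re - J ≤ ‖p‖ ^ 2 / J := by
  rw [le_div_iff₀ h0, norm_sq_eq_re_im]
  nlinarith [sq_nonneg (p.re - J), sq_nonneg p.im]

theorem two_mul_im_sub_le (h0 : 0 < J) : 2 * (a * q.im) - J ≤ a ^ 2 * (‖q‖ ^ 2 / J) := by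
  rw [← mul_div_assoc, le_div_iff₀ h0, norm_sq_eq_re_im]
  nlinarith [sq_nonneg (a * q.im - J), mul_nonneg (sq_nonneg a) (sq_nonneg q.re)]

theorem weighted_tangent_le (hr : 1 < r) (ha : 0 < a) (hw : 0 < w) (hα : w * slope r a = α)
    {t : ℝ} (ht : 0 < t) :
    w * density r a + α * (t - a) ≤ w * density r t ∧
      (w * density r a + α * (t - a) = w * density r t → t = a) := by
  have e : w * density r a + α * (t - a) = w * (density r a + slope r a * (t - a)) := by
    rw [← hα]; ring
  rw [e]
  refine ⟨mul_le_mul_of_nonneg_left (density_tangent_le hr ha ht) hw.le, fun h => ?_⟩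
  by_contra hne
  exact (density_tangent_lt hr ha ht hne).ne (mul_left_cancel₀ hw.ne' h)

/-- The tangent is taken at 1/a. The symmetry of the density turns its slope into -a² times the
slope at a. -/
theorem weighted_tangent_inv_le (hr : 1 < r) (ha : 0 < a) (hw : 0 < w)
    (hα : w * slope r a = α) {t : ℝ} (ht : 0 < t) :
    w * density r a + -α * (a ^ 2 * t - a) ≤ w * density r t ∧
      (w * density r a + -α * (a ^ 2 * t - a) = w * density r t → a ^ 2 * t = a) := by
  have hs : w * slope r a⁻¹ = -(a ^ 2 * α) := by rw [slope_inv ha, ← hα]; ring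
  have h := weighted_tangent_le hr (inv_pos.2 ha) hw hs ht
  have e : -(a ^ 2 * α) * (t - a⁻¹) = -α * (a ^ 2 * t - a) := by field_simp
  rw [e, density_inv] at h
  refine ⟨h.1, fun h' => ?_⟩
  rw [h.2 h']
  field_simp

/-- The pointwise distortion as a function of the two partial derivatives. -/
noncomputable def pointDistortion (p q : ℂ) : ℝ :=
  if 0 < p.re * q.im - p.im * q.re then
    (‖p‖ ^ 2 + ‖q‖ ^ 2) / (2 * (p.re * q.im - p.im * q.re)) else 1

theorem measurable_pointDistortion : Measurable fun x : ℂ × ℂ => pointDistortion x.1 x.2 := by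
  have hJ : Measurable fun x : ℂ × ℂ => x.1.re * x.2.im - x.1.im * x.2.re := by fun_prop
  refine Measurable.ite (measurableSet_lt measurable_const hJ) ?_ measurable_const
  fun_prop

theorem one_le_pointDistortion (p q : ℂ) : 1 ≤ pointDistortion p q := by
  unfold pointDistortion
  split_ifs with h
  · exact one_le_distortion rfl h
  · exact le_rfl

/-- From |p|² + |q|² = 2KJ ≤ (K + J)². This bounds the derivatives by integrable functions. -/
theorem norm_le_pointDistortion_add (hJ : J = p.re * q.im - p.im * q.re) (hJ0 : 0 ≤ J)
    (hz : J = 0 → p = 0 ∧ q = 0) :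
    ‖p‖ ≤ pointDistortion p q + J ∧ ‖q‖ ≤ pointDistortion p q + J := by
  have h1 := one_le_pointDistortion p q
  rcases hJ0.eq_or_lt with h | h
  · obtain ⟨rfl, rfl⟩ := hz h.symm
    rw [norm_zero]
    constructor <;> linarith
  · have e : ‖p‖ ^ 2 + ‖q‖ ^ 2 = 2 * (pointDistortion p q * J) := by
      rw [pointDistortion, ← hJ, if_pos h]
      field_simp
    have hp := sq_nonneg ‖p‖
    have hq := sq_nonneg ‖q‖
    constructor
    · exact abs_le_of_sq_le_sq' (by nlinarith) (by linarith) |>.2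
    · exact abs_le_of_sq_le_sq' (by nlinarith) (by linarith) |>.2

theorem pointwise_horizontal (hr : 1 < r) (ha : 0 < a) (hw : 0 < w) (hα : w * slope r a = α)
    (hα0 : 0 ≤ α) (hJ : J = p.re * q.im - p.im * q.re) (hJ0 : 0 ≤ J)
    (hz : J = 0 → p = 0 ∧ q = 0) :
    w * density r a + α * (‖p‖ ^ 2 / J - a) ≤ pointDistortion p q ^ r * w ∧
      2 * p.re - J ≤ ‖p‖ ^ 2 / J ∧
      (pointDistortion p q ^ r * w = w * density r a + α * (‖p‖ ^ 2 / J - a) →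
        ‖p‖ ^ 2 / J ≤ a) := by
  rcases hJ0.eq_or_lt with h | h
  -- Where J = 0 the derivative vanishes, the distortion is 1 and the quotient by J is 0 by
  -- convention. The tangent inequality at t = 1 still suffices, as α ≥ 0. In the equality clause
  -- only ≤ is available here.
  · obtain ⟨rfl, rfl⟩ := hz h.symm
    have hd : pointDistortion 0 0 = 1 := by simp [pointDistortion]
    have ht := (weighted_tangent_le hr ha hw hα one_pos).1
    rw [density_one] at ht
    rw [← h, hd, Real.one_rpow]
    refine ⟨?_, by simp, fun _ => by simpa using ha.le⟩
    simp only [div_zero]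
    nlinarith
  · have hd : pointDistortion p q = (‖p‖ ^ 2 + ‖q‖ ^ 2) / (2 * J) := by
      rw [pointDistortion, ← hJ, if_pos h]
    have hP : 0 < ‖p‖ ^ 2 / J := div_pos (norm_sq_pos hJ h).1 h
    have hle := mul_le_mul_of_nonneg_left (density_le_of_jacobian_pos hr hJ h).1 hw.le
    have ht := weighted_tangent_le hr ha hw hα hP
    rw [hd, mul_comm _ w]
    exact ⟨ht.1.trans hle, two_mul_re_sub_le h, fun he =>
      (ht.2 (le_antisymm ht.1 (he ▸ hle))).le⟩

theorem pointwise_vertical (hr : 1 < r) (ha : 0 < a) (hw : 0 < w) (hα : w * slope r a = α)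
    (hα0 : α ≤ 0) (hJ : J = p.re * q.im - p.im * q.re) (hJ0 : 0 ≤ J)
    (hz : J = 0 → p = 0 ∧ q = 0) :
    w * density r a + -α * (a ^ 2 * (‖q‖ ^ 2 / J) - a) ≤ pointDistortion p q ^ r * w ∧
      2 * (a * q.im) - J ≤ a ^ 2 * (‖q‖ ^ 2 / J) ∧
      (pointDistortion p q ^ r * w = w * density r a + -α * (a ^ 2 * (‖q‖ ^ 2 / J) - a) →
        a ^ 2 * (‖q‖ ^ 2 / J) ≤ a) := by
  rcases hJ0.eq_or_lt with h | h
  · obtain ⟨rfl, rfl⟩ := hz h.symm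
    have hd : pointDistortion 0 0 = 1 := by simp [pointDistortion]
    have ht := (weighted_tangent_inv_le hr ha hw hα one_pos).1
    rw [density_one] at ht
    rw [← h, hd, Real.one_rpow]
    refine ⟨?_, by simp, fun _ => by simpa using ha.le⟩
    simp only [div_zero]
    nlinarith [mul_nonneg (neg_nonneg.2 hα0) (sq_nonneg a)]
  · have hd : pointDistortion p q = (‖p‖ ^ 2 + ‖q‖ ^ 2) / (2 * J) := by
      rw [pointDistortion, ← hJ, if_pos h]
    have hQ : 0 < ‖q‖ ^ 2 / J := div_pos (norm_sq_pos hJ h).2 h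
    have hle := mul_le_mul_of_nonneg_left (density_le_of_jacobian_pos hr hJ h).2 hw.le
    have ht := weighted_tangent_inv_le hr ha hw hα hQ
    rw [hd, mul_comm _ w]
    exact ⟨ht.1.trans hle, two_mul_im_sub_le h, fun he =>
      (ht.2 (le_antisymm ht.1 (he ▸ hle))).le⟩

theorem norm_sq_add_of_rpow_eq (hr : 1 < r) (ha : 0 < a) (hw : 0 < w)
    (hJ : a = p.re * q.im - p.im * q.re) (he : pointDistortion p q ^ r * w = w * density r a) :
    ‖p‖ ^ 2 + ‖q‖ ^ 2 = a ^ 2 + 1 := by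
  rw [mul_comm] at he
  have h1 := mul_left_cancel₀ hw.ne' he
  have h2 := (Real.rpow_left_inj (by linarith [one_le_pointDistortion p q])
    (by linarith [one_le_half_add_inv ha]) (by linarith)).1 h1
  rw [pointDistortion, ← hJ, if_pos ha] at h2
  field_simp at h2
  linarith

/-- Eliminating a from the two equalities gives (Re p - J)² + (Im p)² = 0, so p = J = a. Then J = a
Im q gives Im q = 1, and equality of the distortions gives |q| = 1. -/
theorem eq_of_horizontal_eq (hr : 1 < r) (ha : 0 < a) (hw : 0 < w)
    (hJ : J = p.re * q.im - p.im * q.re) (hJ0 : 0 ≤ J) (hz : J = 0 → p = 0 ∧ q = 0)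
    (he : pointDistortion p q ^ r * w = w * density r a) (hS : ‖p‖ ^ 2 / J = a)
    (hN : 2 * p.re - J = a) : p = a ∧ q = I := by
  have hJpos : 0 < J := by
    refine lt_of_le_of_ne hJ0 fun h => ?_
    obtain ⟨rfl, rfl⟩ := hz h.symm
    simp [← h] at hN
    linarith
  rw [div_eq_iff hJpos.ne', norm_sq_eq_re_im] at hS
  have hsum : (p.re - J) ^ 2 + p.im ^ 2 = 0 := by nlinarith
  have h1 : p.re = J := by nlinarith [sq_nonneg (p.re - J), sq_nonneg p.im]
  have h2 : p.im = 0 := by nlinarith [sq_nonneg (p.re - J), sq_nonneg p.im]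
  have hJa : J = a := by linarith
  have hpa : p.re = a := by linarith
  have hn := norm_sq_add_of_rpow_eq hr ha hw (hJa ▸ hJ) he
  rw [norm_sq_eq_re_im, norm_sq_eq_re_im, hpa, h2] at hn
  rw [hpa, h2, hJa, zero_mul, sub_zero] at hJ
  have hqi : q.im = 1 := by
    have : a * 1 = a * q.im := by linarith
    exact (mul_left_cancel₀ ha.ne' this).symm
  rw [hqi] at hn
  have hqr : q.re = 0 := by nlinarith
  exact ⟨Complex.ext (by simpa using hpa) (by simpa using h2),
    Complex.ext (by simpa using hqr) (by simpa using hqi)⟩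

/-- Here the two equalities give |q - i|² = 0 and then J = a, so Re p = a. The distortion leaves no
room for Im p. -/
theorem eq_of_vertical_eq (hr : 1 < r) (ha : 0 < a) (hw : 0 < w)
    (hJ : J = p.re * q.im - p.im * q.re) (hJ0 : 0 ≤ J) (hz : J = 0 → p = 0 ∧ q = 0)
    (he : pointDistortion p q ^ r * w = w * density r a) (hS : a ^ 2 * (‖q‖ ^ 2 / J) = a)
    (hN : 2 * (a * q.im) - J = a) : p = a ∧ q = I := by
  have hJpos : 0 < J := by
    refine lt_of_le_of_ne hJ0 fun h => ?_
    obtain ⟨rfl, rfl⟩ := hz h.symm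
    simp [← h] at hN
    linarith
  rw [← mul_div_assoc, div_eq_iff hJpos.ne', norm_sq_eq_re_im] at hS
  have hS' : a * (q.re ^ 2 + q.im ^ 2) = J := by
    refine mul_left_cancel₀ ha.ne' ?_
    linarith
  have hsum : a * ((q.im - 1) ^ 2 + q.re ^ 2) = a * 0 := by linarith
  have hsum' := mul_left_cancel₀ ha.ne' hsum
  have hqi : q.im = 1 := by nlinarith [sq_nonneg (q.im - 1), sq_nonneg q.re]
  have hqr : q.re = 0 := by nlinarith [sq_nonneg (q.im - 1), sq_nonneg q.re]
  have hJa : J = a := by rw [hqi] at hN; linarith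
  have hn := norm_sq_add_of_rpow_eq hr ha hw (hJa ▸ hJ) he
  rw [hqi, hqr, hJa] at hJ
  have hpa : p.re = a := by linarith
  rw [norm_sq_eq_re_im, norm_sq_eq_re_im, hpa, hqi, hqr] at hn
  have h2 : p.im = 0 := by nlinarith
  exact ⟨Complex.ext (by simpa using hpa) (by simpa using h2),
    Complex.ext (by simpa using hqr) (by simpa using hqi)⟩

end Pointwise

/-! ### The integrated calibration inequality -/

section Calibration

variable {X : Type*} [MeasurableSpace X] {μ : Measure X} {e e₀ S N J A : X → ℝ} {β L : ℝ}

/-- The lower bound e₀ + β(2N - J - A) has integral at least that of e₀, because β ≥ 0 and the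
integral of J is at most L. In the equality part β may be 0, so equality of integrals alone says
nothing about S; the extra implication supplies S ≤ A, and comparison of integrals turns the chain
2N - J ≤ S ≤ A into equalities. -/
theorem integral_le_of_calibration (hβ : 0 ≤ β) (he : Integrable e μ) (he₀ : Integrable e₀ μ)
    (hNi : Integrable N μ) (hJi : Integrable J μ) (hAi : Integrable A μ)
    (h1 : ∀ᵐ z ∂μ, e₀ z + β * (S z - A z) ≤ e z) (h2 : ∀ᵐ z ∂μ, 2 * N z - J z ≤ S z)
    (hN : ∫ z, N z ∂μ = L) (hJ : ∫ z, J z ∂μ ≤ L) (hA : ∫ z, A z ∂μ = L) :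
    ∫ z, e₀ z ∂μ ≤ ∫ z, e z ∂μ ∧
    ((∀ᵐ z ∂μ, e z = e₀ z + β * (S z - A z) → S z ≤ A z) → ∫ z, e z ∂μ ≤ ∫ z, e₀ z ∂μ →
      ∀ᵐ z ∂μ, e z = e₀ z ∧ S z = A z ∧ 2 * N z - J z = A z) := by
  have hDi : Integrable (fun z => 2 * N z - J z) μ := (hNi.const_mul 2).sub hJi
  have hTi : Integrable (fun z => 2 * N z - J z - A z) μ := hDi.sub hAi
  have hT : 0 ≤ ∫ z, (2 * N z - J z - A z) ∂μ := by
    rw [integral_sub hDi hAi, integral_sub (hNi.const_mul 2) hJi,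
      integral_const_mul, hN, hA]
    linarith
  have hle : ∀ᵐ z ∂μ, e₀ z + β * (2 * N z - J z - A z) ≤ e z := by
    filter_upwards [h1, h2] with z z1 z2
    refine le_trans ?_ z1
    gcongr
  have hint : Integrable (fun z => e₀ z + β * (2 * N z - J z - A z)) μ := he₀.add (hTi.const_mul β)
  have hval : ∫ z, (e₀ z + β * (2 * N z - J z - A z)) ∂μ
      = ∫ z, e₀ z ∂μ + β * ∫ z, (2 * N z - J z - A z) ∂μ := by
    rw [integral_add he₀ (hTi.const_mul β), integral_const_mul]
  have hmono := integral_mono_ae hint he hle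
  rw [hval] at hmono
  have hβT := mul_nonneg hβ hT
  refine ⟨by linarith, fun h3 hge => ?_⟩
  -- Equal integrals of ordered functions force equality almost everywhere, and the intermediate
  -- bound involving S is squeezed.
  have heq := (integral_eq_iff_of_ae_le hint he hle).1 (by rw [hval]; linarith)
  have hSA : ∀ᵐ z ∂μ, 2 * N z - J z ≤ A z := by
    filter_upwards [heq, h1, h2, h3] with z z0 z1 z2 z3
    have : β * (2 * N z - J z - A z) ≤ β * (S z - A z) := by gcongr
    exact z2.trans (z3 (by linarith))
  have hT0 := (integral_eq_iff_of_ae_le hDi hAi hSA).1 (by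
    refine le_antisymm (integral_mono_ae hDi hAi hSA) ?_
    rw [integral_sub hDi hAi] at hT
    exact sub_nonneg.1 hT)
  filter_upwards [heq, h1, h2, h3, hT0] with z z0 z1 z2 z3 z4
  have : β * (2 * N z - J z - A z) ≤ β * (S z - A z) := by gcongr
  have hS := z3 (by linarith)
  have z4' : 2 * N z - J z = A z := z4
  refine ⟨?_, le_antisymm hS (z4' ▸ z2), z4'⟩
  rw [z4', sub_self, mul_zero, add_zero] at z0
  exact z0.symm

end Calibration

end

/-! ### The calibration hypotheses for admissible mappings -/

section

theorem coordRect_re_im (l : ℝ) : coordRect reCLM imCLM l 1 = openRect l := rfl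

theorem coordRect_im_re (l : ℝ) : coordRect imCLM reCLM 1 l = openRect l := by
  ext z
  exact and_comm

theorem closedCoordRect_re_im (l : ℝ) : closedCoordRect reCLM imCLM l 1 = rect l := rfl

theorem closedCoordRect_im_re (l : ℝ) : closedCoordRect imCLM reCLM 1 l = rect l := by
  ext z
  exact and_comm

theorem volume_rect (l : ℝ) : volume (rect l) = ENNReal.ofReal l := by
  rw [← isCoord_re_im.measurePreserving.measure_preimage_emb isCoord_re_im.measurableEmbedding]
  have : (fun x : ℝ × ℝ => (x.1 : ℂ) + x.2 * I) ⁻¹' rect l = Icc 0 l ×ˢ Icc 0 1 := by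
    ext x; simp [mem_rect, -Icc_prod_Icc]
  rw [this, Measure.volume_eq_prod, Measure.prod_prod, Real.volume_Icc, Real.volume_Icc]
  simp

theorem volume_openRect (l : ℝ) : volume (openRect l) = ENNReal.ofReal l := by
  rw [← isCoord_re_im.measurePreserving.measure_preimage_emb isCoord_re_im.measurableEmbedding]
  have : (fun x : ℝ × ℝ => (x.1 : ℂ) + x.2 * I) ⁻¹' openRect l = Ioo 0 l ×ˢ Ioo 0 1 := by
    ext x; simp [openRect, mem_reProdIm]
  rw [this, Measure.volume_eq_prod, Measure.prod_prod, Real.volume_Ioo, Real.volume_Ioo]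
  simp

theorem openRect_subset_rect (l : ℝ) : openRect l ⊆ rect l :=
  fun _ hz => ⟨Ioo_subset_Icc_self hz.1, Ioo_subset_Icc_self hz.2⟩

theorem restrict_rect (l : ℝ) : volume.restrict (rect l) = volume.restrict (openRect l) := by
  refine (Measure.restrict_congr_set ?_).symm
  refine ae_eq_of_subset_of_measure_ge (openRect_subset_rect l) ?_
    (isOpen_openRect l).measurableSet.nullMeasurableSet ?_
  · rw [volume_rect, volume_openRect]
  · rw [volume_rect]; exact ENNReal.ofReal_ne_top

instance (l : ℝ) : IsFiniteMeasure (volume.restrict (openRect l)) :=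
  ⟨by rw [Measure.restrict_apply_univ, volume_openRect]; exact ENNReal.ofReal_lt_top⟩

variable {l L r : ℝ} {g : ℂ → ℂ}

theorem Admissible.hasWeakDeriv_one (h : Admissible l L g) :
    HasWeakDeriv (openRect l) 1 g (weakDeriv (openRect l) 1 g) :=
  hasWeakDeriv_weakDeriv h.finiteDistortion.memSobolevLoc.1

theorem Admissible.hasWeakDeriv_I (h : Admissible l L g) :
    HasWeakDeriv (openRect l) I g (weakDeriv (openRect l) I g) :=
  hasWeakDeriv_weakDeriv h.finiteDistortion.memSobolevLoc.2

theorem Admissible.ae_jacobian (h : Admissible l L g) :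
    ∀ᵐ z ∂volume.restrict (openRect l), 0 ≤ jacobian (openRect l) g z ∧
      (jacobian (openRect l) g z = 0 →
        weakDeriv (openRect l) 1 g z = 0 ∧ weakDeriv (openRect l) I g z = 0) := by
  obtain ⟨K, hK⟩ := h.finiteDistortion.exists_bound
  filter_upwards [h.finiteDistortion.jacobian_nonneg, hK] with z h1 h2
  refine ⟨h1, fun h0 => ?_⟩
  rw [h0, mul_zero, normSqDeriv] at h2
  have a1 := sq_nonneg ‖weakDeriv (openRect l) 1 g z‖
  have a2 := sq_nonneg ‖weakDeriv (openRect l) I g z‖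
  constructor
  · rw [← norm_eq_zero, ← sq_eq_zero_iff]; linarith
  · rw [← norm_eq_zero, ← sq_eq_zero_iff]; linarith

theorem Admissible.aestronglyMeasurable_weakDeriv (h : Admissible l L g) :
    AEStronglyMeasurable (weakDeriv (openRect l) 1 g) (volume.restrict (openRect l)) ∧
      AEStronglyMeasurable (weakDeriv (openRect l) I g) (volume.restrict (openRect l)) :=
  ⟨h.hasWeakDeriv_one.locallyIntegrable_deriv.aestronglyMeasurable,
    h.hasWeakDeriv_I.locallyIntegrable_deriv.aestronglyMeasurable⟩

theorem Admissible.integrable_jacobian (h : Admissible l L g) (hL : 0 ≤ L) :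
    IntegrableOn (jacobian (openRect l) g) (openRect l) ∧
      ∫ z in openRect l, jacobian (openRect l) g z ≤ L := by
  have hle := lintegral_jacobian_le (isOpen_openRect l)
    (h.continuousOn.mono (openRect_subset_rect l)) (h.bijOn.injOn.mono (openRect_subset_rect l))
    h.hasWeakDeriv_one h.hasWeakDeriv_I
  have himg : volume (g '' openRect l) ≤ ENNReal.ofReal L := by
    rw [← volume_rect]
    exact measure_mono ((image_mono (openRect_subset_rect l)).trans h.bijOn.image_eq.subset)
  have hle2 : ∫⁻ z in openRect l, ENNReal.ofReal (jacobian (openRect l) g z)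
      ≤ ENNReal.ofReal L := by
    refine le_trans (lintegral_mono fun z => ?_) (hle.trans himg)
    rw [det_lin]
    exact ENNReal.ofReal_le_ofReal (le_abs_self _)
  have hnn : 0 ≤ᵐ[volume.restrict (openRect l)] jacobian (openRect l) g :=
    h.finiteDistortion.jacobian_nonneg
  have hm : AEStronglyMeasurable (jacobian (openRect l) g) (volume.restrict (openRect l)) := by
    obtain ⟨m1, m2⟩ := h.aestronglyMeasurable_weakDeriv
    exact ((reCLM.continuous.comp_aestronglyMeasurable m1).mul
      (imCLM.continuous.comp_aestronglyMeasurable m2)).sub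
      ((imCLM.continuous.comp_aestronglyMeasurable m1).mul
      (reCLM.continuous.comp_aestronglyMeasurable m2))
  refine ⟨(lintegral_ofReal_ne_top_iff_integrable hm hnn).1
    (hle2.trans_lt ENNReal.ofReal_lt_top).ne, ?_⟩
  rw [integral_eq_lintegral_of_nonneg_ae hnn hm]
  exact ENNReal.toReal_le_of_le_ofReal hL hle2

/-- The integrand of the energy. -/
noncomputable def integrand (l r : ℝ) (w : ℝ → ℝ) (g : ℂ → ℂ) (z : ℂ) : ℝ :=
  distortion (openRect l) g z ^ r * w z.re

theorem one_le_distortion_fun (Ω : Set ℂ) (g : ℂ → ℂ) (z : ℂ) : 1 ≤ distortion Ω g z :=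
  one_le_pointDistortion (weakDeriv Ω 1 g z) (weakDeriv Ω I g z)

theorem energy_eq {lam w : ℝ → ℝ} (hlam : ∀ᵐ x, x ∈ Icc 0 l → lam x = w x) (g : ℂ → ℂ) :
    energy l r lam g = ∫⁻ z in openRect l, ENNReal.ofReal (integrand l r w g z) := by
  rw [energy, restrict_rect]
  apply lintegral_congr_ae
  rw [EventuallyEq, ae_restrict_iff' (isOpen_openRect l).measurableSet]
  filter_upwards [ae_re hlam] with z hz hzl
  rw [integrand, hz (openRect_subset_rect l hzl).1]

variable {w : ℝ → ℝ} {c : ℝ}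

theorem Admissible.aestronglyMeasurable_distortion (h : Admissible l L g) :
    AEStronglyMeasurable (distortion (openRect l) g) (volume.restrict (openRect l)) := by
  obtain ⟨m1, m2⟩ := h.aestronglyMeasurable_weakDeriv
  exact (measurable_pointDistortion.comp_aemeasurable
    (m1.aemeasurable.prodMk m2.aemeasurable)).aestronglyMeasurable

/-- Since K ≥ 1 and w ≥ c, the integrand dominates cK. Hence K is integrable, and so are the weak
derivatives, being bounded by K + J. This gives integrability up to the boundary, where the
definition grants only local integrability. -/
theorem Admissible.integrable_of_energy_lt_top (h : Admissible l L g) (hL : 0 ≤ L) (hr : 1 < r)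
    (hw : Measurable w) (hc : 0 < c) (hcw : ∀ x, c ≤ w x)
    (hfin : ∫⁻ z in openRect l, ENNReal.ofReal (integrand l r w g z) < ⊤) :
    IntegrableOn (integrand l r w g) (openRect l) ∧
      IntegrableOn (weakDeriv (openRect l) 1 g) (openRect l) ∧
      IntegrableOn (weakDeriv (openRect l) I g) (openRect l) := by
  have hd := h.aestronglyMeasurable_distortion
  have h1 := one_le_distortion_fun (openRect l) g
  have hm : AEStronglyMeasurable (integrand l r w g) (volume.restrict (openRect l)) :=
    ((hd.aemeasurable.pow_const r).mul
      (hw.comp Complex.measurable_re).aemeasurable).aestronglyMeasurable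
  have hnn : ∀ z, 0 ≤ integrand l r w g z := fun z =>
    mul_nonneg (Real.rpow_nonneg (by linarith [h1 z]) _) (hc.le.trans (hcw _))
  have hint : IntegrableOn (integrand l r w g) (openRect l) :=
    (lintegral_ofReal_ne_top_iff_integrable hm (Eventually.of_forall hnn)).1 hfin.ne
  have hdint : IntegrableOn (distortion (openRect l) g) (openRect l) := by
    refine (hint.div_const c).mono' hd (Eventually.of_forall fun z => ?_)
    rw [Real.norm_of_nonneg (by linarith [h1 z]), le_div_iff₀ hc, integrand]
    have := Real.self_le_rpow_of_one_le (h1 z) hr.le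
    have h0 : 0 ≤ distortion (openRect l) g z := by linarith [h1 z]
    exact mul_le_mul this (hcw _) hc.le (h0.trans this)
  have hsum := hdint.add (h.integrable_jacobian hL).1
  have hbd : ∀ᵐ z ∂volume.restrict (openRect l),
      ‖weakDeriv (openRect l) 1 g z‖ ≤ (distortion (openRect l) g + jacobian (openRect l) g) z ∧
      ‖weakDeriv (openRect l) I g z‖ ≤
        (distortion (openRect l) g + jacobian (openRect l) g) z := by
    filter_upwards [h.ae_jacobian] with z hz
    exact norm_le_pointDistortion_add rfl hz.1 hz.2
  exact ⟨hint, hsum.mono' h.aestronglyMeasurable_weakDeriv.1 (hbd.mono fun _ h => h.1),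
    hsum.mono' h.aestronglyMeasurable_weakDeriv.2 (hbd.mono fun _ h => h.2)⟩

theorem Admissible.integral_re (h : Admissible l L g) (hl : 0 < l)
    (hint : IntegrableOn (weakDeriv (openRect l) 1 g) (openRect l)) :
    ∫ z in openRect l, (weakDeriv (openRect l) 1 g z).re = L := by
  have := integral_weighted isCoord_re_im hl zero_le_one (by
    rw [closedCoordRect_re_im]; exact h.continuousOn) h.hasWeakDeriv_one hint reCLM (c := L)
    (fun y hy => by
      have h1 := h.right y hy
      have h2 := h.left y hy
      simp only [reCLM_apply, ofReal_zero, zero_add, h1, h2, sub_zero])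
    (w := fun _ => 1) measurable_const (M := 1) (by simp)
  simpa [coordRect_re_im] using this

theorem Admissible.integral_weighted_im (h : Admissible l L g) (hl : 0 < l) {a : ℝ → ℝ} {M : ℝ}
    (ha : Measurable a) (hM : ∀ x, |a x| ≤ M)
    (hint : IntegrableOn (weakDeriv (openRect l) I g) (openRect l)) :
    ∫ z in openRect l, a z.re * (weakDeriv (openRect l) I g z).im = ∫ x in (0 : ℝ)..l, a x := by
  have := integral_weighted isCoord_im_re one_pos hl.le (g := g)
    (G := weakDeriv (openRect l) I g) (by
    rw [closedCoordRect_im_re]; exact h.continuousOn) (by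
    rw [coordRect_im_re]; exact h.hasWeakDeriv_I) (by
    rw [coordRect_im_re]; exact hint) imCLM (c := 1)
    (fun y hy => by
      have h1 := h.top y hy
      have h2 := h.bottom y hy
      simp only [imCLM_apply, ofReal_zero, zero_mul, add_zero, ofReal_one, one_mul, h1, h2,
        sub_zero])
    (w := a) ha hM
  rw [coordRect_im_re] at this
  rw [intervalIntegral.integral_of_le hl.le, integral_Ioc_eq_integral_Ioo]
  simpa using this

/-- The difference is constant along horizontal and vertical lines. Its real part vanishes on the
left side and its imaginary part on the bottom side. -/
theorem Admissible.eqOn_of_ae_weakDeriv_eq {f : ℂ → ℂ} (hf : Admissible l L f)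
    (hg : Admissible l L g) (hl : 0 < l)
    (h1 : ∀ᵐ z ∂volume.restrict (openRect l),
      weakDeriv (openRect l) 1 g z = weakDeriv (openRect l) 1 f z)
    (hI : ∀ᵐ z ∂volume.restrict (openRect l),
      weakDeriv (openRect l) I g z = weakDeriv (openRect l) I f z) : EqOn g f (rect l) := by
  have hcont : ContinuousOn (fun z => g z - f z) (rect l) := hg.continuousOn.sub hf.continuousOn
  intro z hz
  have hz' := mem_rect.1 hz
  have e1 := eq_of_weakDeriv_eq_zero isCoord_re_im one_pos (a := l)
    (d := fun z => g z - f z) hcont (hg.hasWeakDeriv_one.sub hf.hasWeakDeriv_one)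
    (h1.mono fun z h => by rw [h, sub_self]) hz'.1 hz'.2
  have e2 := eq_of_weakDeriv_eq_zero isCoord_im_re hl (a := 1) (d := fun z => g z - f z)
    (by rw [closedCoordRect_im_re]; exact hcont)
    (by rw [coordRect_im_re]; exact hg.hasWeakDeriv_I.sub hf.hasWeakDeriv_I)
    (by rw [coordRect_im_re]; exact hI.mono fun z h => by rw [h, sub_self]) hz'.2 hz'.1
  simp only [ofReal_zero, zero_add, zero_mul, add_zero, re_add_im] at e1 e2
  have r1 := congrArg Complex.re e1
  have i2 := congrArg Complex.im e2
  rw [sub_re, sub_re, hg.left _ hz'.2, hf.left _ hz'.2] at r1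
  rw [sub_im, sub_im, hg.bottom _ hz'.1, hf.bottom _ hz'.1] at i2
  exact Complex.ext (by linarith) (by linarith)

end

/-! ### Minimality, uniqueness and the theorem -/

/-- Minimality and uniqueness in terms of Bochner integrals: a calibration argument. -/
theorem Admissible.calibration {l L r c m M α : ℝ} {w a : ℝ → ℝ} {g : ℂ → ℂ}
    (h : Admissible l L g) (hl : 0 < l) (hL : 0 ≤ L) (hr : 1 < r) (hw : Measurable w) (hc : 0 < c)
    (hcw : ∀ x, c ≤ w x) (ha : Measurable a) (hm0 : 0 < m) (hm : ∀ x, m ≤ a x)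
    (hM : ∀ x, a x ≤ M) (hα : ∀ x, w x * slope r (a x) = α)
    (haL : ∫ x in (0 : ℝ)..l, a x = L)
    (he₀ : IntegrableOn (fun z => w z.re * density r (a z.re)) (openRect l))
    (hA : ∫ z in openRect l, a z.re = L)
    (hfin : ∫⁻ z in openRect l, ENNReal.ofReal (integrand l r w g z) < ⊤) :
    ∫ z in openRect l, w z.re * density r (a z.re) ≤ ∫ z in openRect l, integrand l r w g z ∧
    (∫ z in openRect l, integrand l r w g z ≤ ∫ z in openRect l, w z.re * density r (a z.re) →
      ∀ᵐ z ∂volume.restrict (openRect l),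
        weakDeriv (openRect l) 1 g z = a z.re ∧ weakDeriv (openRect l) I g z = I) := by
  obtain ⟨he, hp, hq⟩ := h.integrable_of_energy_lt_top hL hr hw hc hcw hfin
  obtain ⟨hJi, hJ⟩ := h.integrable_jacobian hL
  have ha0 : ∀ x, 0 < a x := fun x => hm0.trans_le (hm x)
  have hw0 : ∀ x, 0 < w x := fun x => hc.trans_le (hcw x)
  have haM : ∀ x, ‖a x‖ ≤ M := fun x => by rw [Real.norm_of_nonneg (ha0 x).le]; exact hM x
  have ham : Measurable fun z : ℂ => a z.re := ha.comp Complex.measurable_re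
  have hAi : IntegrableOn (fun z => a z.re) (openRect l) :=
    Integrable.of_bound ham.aestronglyMeasurable M (Eventually.of_forall fun z => haM _)
  -- The multiplier β must be nonnegative, so β = α goes with the horizontal derivative and β = -α
  -- with the vertical one.
  rcases le_total 0 α with hα0 | hα0
  · have key : ∀ᵐ z ∂volume.restrict (openRect l), _ := h.ae_jacobian.mono fun z hz =>
      pointwise_horizontal hr (ha0 z.re) (hw0 z.re) (hα z.re) hα0 rfl hz.1 hz.2
    obtain ⟨c1, c2⟩ := integral_le_of_calibration
      (S := fun z => ‖weakDeriv (openRect l) 1 g z‖ ^ 2 / jacobian (openRect l) g z)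
      hα0 he he₀ hp.re hJi hAi
      (key.mono fun z k => k.1) (key.mono fun z k => k.2.1) (h.integral_re hl hp) hJ hA
    refine ⟨c1, fun hle => ?_⟩
    filter_upwards [c2 (key.mono fun z k => k.2.2) hle, h.ae_jacobian] with z hz hz0
    exact eq_of_horizontal_eq hr (ha0 z.re) (hw0 z.re) rfl hz0.1 hz0.2 hz.1 hz.2.1 hz.2.2
  · have key : ∀ᵐ z ∂volume.restrict (openRect l), _ := h.ae_jacobian.mono fun z hz =>
      pointwise_vertical hr (ha0 z.re) (hw0 z.re) (hα z.re) hα0 rfl hz.1 hz.2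
    have hNi : IntegrableOn (fun z => a z.re * (weakDeriv (openRect l) I g z).im) (openRect l) :=
      hq.im.bdd_mul ham.aestronglyMeasurable (Eventually.of_forall fun z => haM _)
    obtain ⟨c1, c2⟩ := integral_le_of_calibration
      (S := fun z => a z.re ^ 2 *
        (‖weakDeriv (openRect l) I g z‖ ^ 2 / jacobian (openRect l) g z))
      (neg_nonneg.2 hα0) he he₀ hNi hJi hAi
      (key.mono fun z k => k.1) (key.mono fun z k => k.2.1)
      ((h.integral_weighted_im hl ha haM hq).trans haL) hJ hA
    refine ⟨c1, fun hle => ?_⟩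
    filter_upwards [c2 (key.mono fun z k => k.2.2) hle, h.ae_jacobian] with z hz hz0
    exact eq_of_vertical_eq hr (ha0 z.re) (hw0 z.re) rfl hz0.1 hz0.2 hz.1 hz.2.1 hz.2.2

/-- The bounds hold only on [0, l] and the weight is arbitrary elsewhere and on the finite set. A
globally bounded measurable version with the same energy lets the stretch factor be defined on all
of ℝ. -/
theorem exists_measurable_weight {l c C : ℝ} {lam : ℝ → ℝ} (hl : 0 ≤ l)
    (hlam : PiecewiseContinuous l lam) (hbelow : ∀ x ∈ Icc 0 l, c ≤ lam x)
    (habove : ∀ x ∈ Icc 0 l, lam x ≤ C) :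
    ∃ w : ℝ → ℝ, Measurable w ∧ (∀ x, c ≤ w x) ∧ (∀ x, w x ≤ C) ∧
      ∀ᵐ x, x ∈ Icc 0 l → lam x = w x := by
  classical
  obtain ⟨S, hS, hcont⟩ := hlam
  have hm : MeasurableSet (Icc 0 l \ S) := measurableSet_Icc.diff hS.measurableSet
  have h0 : (0 : ℝ) ∈ Icc 0 l := left_mem_Icc.2 hl
  refine ⟨(Icc 0 l \ S).piecewise lam fun _ => c,
    hcont.measurable_piecewise continuousOn_const hm, fun x => ?_, fun x => ?_, ?_⟩
  · by_cases hx : x ∈ Icc 0 l \ S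
    · rw [piecewise_eq_of_mem _ _ _ hx]; exact hbelow x hx.1
    · rw [piecewise_eq_of_notMem _ _ _ hx]
  · by_cases hx : x ∈ Icc 0 l \ S
    · rw [piecewise_eq_of_mem _ _ _ hx]; exact habove x hx.1
    · rw [piecewise_eq_of_notMem _ _ _ hx]; exact (hbelow 0 h0).trans (habove 0 h0)
  · filter_upwards [measure_eq_zero_iff_ae_notMem.1 (hS.measure_zero volume)] with x hxS hx
    have hmem : x ∈ Icc 0 l \ S := ⟨hx, hxS⟩
    rw [piecewise_eq_of_mem _ _ _ hmem]

/-- The weighted Grötzsch problem has a unique minimiser, and it is a horizontal stretch. -/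
theorem exists_unique_minimiser (l L p : ℝ) (hl : 0 < l) (hL : 0 < L) (hp : 1 < p)
    (lam : ℝ → ℝ) (hlam : PiecewiseContinuous l lam)
    (hbelow : ∃ c : ℝ, 0 < c ∧ ∀ x ∈ Icc 0 l, c ≤ lam x)
    (habove : ∃ C : ℝ, ∀ x ∈ Icc 0 l, lam x ≤ C) :
    ∃ f : ℂ → ℂ, IsMinimiser l L p lam f ∧
      energy l p lam f < ⊤ ∧
      (∃ u : ℝ → ℝ, ∀ z ∈ rect l, f z = (u z.re : ℂ) + (z.im : ℂ) * I) ∧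
      ∀ g : ℂ → ℂ, IsMinimiser l L p lam g → EqOn g f (rect l) := by
  obtain ⟨c, hc, hbelow⟩ := hbelow
  obtain ⟨C, habove⟩ := habove
  obtain ⟨w, hw, hcw, hwC, hae⟩ := exists_measurable_weight hl.le hlam hbelow habove
  obtain ⟨α, a, m, M, hm0, ha, hm, hM, hα, haL⟩ := exists_stretch hl hL hp hc hw hcw hwC
  have hf : Admissible l L (stretch a) := admissible_stretch hl ha hm0 hm hM haL
  have ha0 : ∀ x, 0 < a x := fun x => hm0.trans_le (hm x)
  have hw0 : ∀ x, 0 < w x := fun x => hc.trans_le (hcw x)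
  have he₀nn : ∀ z : ℂ, 0 ≤ w z.re * density p (a z.re) := fun z =>
    mul_nonneg (hw0 _).le (Real.rpow_nonneg (by linarith [one_le_half_add_inv (ha0 z.re)]) _)
  have hdm : Measurable fun x => density p (a x) :=
    ((ha.add ha.inv).div_const 2).pow_const p
  have he₀ : IntegrableOn (fun z => w z.re * density p (a z.re)) (openRect l) := by
    refine Integrable.of_bound ((hw.mul hdm).comp Complex.measurable_re).aestronglyMeasurable
      (C * ((M + m⁻¹) / 2) ^ p) (Eventually.of_forall fun z => ?_)
    rw [Real.norm_of_nonneg (he₀nn z)]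
    have h1 := one_le_half_add_inv (ha0 z.re)
    have h2 : (a z.re)⁻¹ ≤ m⁻¹ := inv_anti₀ hm0 (hm _)
    have h3 : density p (a z.re) ≤ ((M + m⁻¹) / 2) ^ p :=
      Real.rpow_le_rpow (by linarith) (by linarith [hM z.re]) (by linarith)
    exact mul_le_mul (hwC _) h3 (Real.rpow_nonneg (by linarith) _) ((hw0 0).le.trans (hwC 0))
  have hEf : energy l p lam (stretch a)
      = ∫⁻ z in openRect l, ENNReal.ofReal (w z.re * density p (a z.re)) := by
    rw [energy_eq hae]
    apply lintegral_congr_ae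
    filter_upwards [ae_distortion_stretch l ha hm0 hm hM] with z hz
    rw [integrand, hz.2.2, mul_comm, density]
  have hEf' : energy l p lam (stretch a)
      = ENNReal.ofReal (∫ z in openRect l, w z.re * density p (a z.re)) := by
    rw [hEf, ofReal_integral_eq_lintegral_ofReal he₀ (Eventually.of_forall he₀nn)]
  -- The weighted boundary identity is applied to the stretch itself, whose vertical derivative is
  -- i; this replaces a direct use of Fubini.
  have hA : ∫ z in openRect l, a z.re = L := by
    have hI := (ae_weakDeriv_stretch l ha hm0 hm hM).mono fun z hz => hz.2
    have hint : IntegrableOn (weakDeriv (openRect l) I (stretch a)) (openRect l) :=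
      (integrable_const I).congr (hI.mono fun z hz => hz.symm)
    rw [← haL, ← hf.integral_weighted_im hl ha (M := M)
      (fun x => by rw [abs_of_pos (ha0 x)]; exact hM x) hint]
    apply integral_congr_ae
    filter_upwards [hI] with z hz
    rw [hz, I_im, mul_one]
  have hEg : ∀ g, Admissible l L g → energy l p lam g < ⊤ → energy l p lam g
      = ENNReal.ofReal (∫ z in openRect l, integrand l p w g z) := by
    intro g hg hfin
    rw [energy_eq hae] at hfin ⊢
    rw [ofReal_integral_eq_lintegral_ofReal
      (hg.integrable_of_energy_lt_top hL.le hp hw hc hcw hfin).1]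
    exact Eventually.of_forall fun z => mul_nonneg
      (Real.rpow_nonneg (by linarith [one_le_distortion_fun (openRect l) g z]) _) (hw0 _).le
  have hcal : ∀ g, Admissible l L g → energy l p lam g < ⊤ → _ := fun g hg hfin =>
    hg.calibration hl hL.le hp hw hc hcw ha hm0 hm hM hα haL he₀ hA (energy_eq hae g ▸ hfin)
  have hfin : energy l p lam (stretch a) < ⊤ := by rw [hEf']; exact ENNReal.ofReal_lt_top
  refine ⟨stretch a, ⟨hf, fun g hg => ?_⟩, hfin, ⟨primitive a, fun z _ => rfl⟩, fun g hg => ?_⟩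
  -- Competitors of infinite energy are set aside, since the calibration requires integrability.
  · rcases eq_or_ne (energy l p lam g) ⊤ with htop | htop
    · rw [htop]; exact le_top
    · rw [hEf', hEg g hg htop.lt_top]
      exact ENNReal.ofReal_le_ofReal (hcal g hg htop.lt_top).1
  · have hle := hg.2 _ hf
    have hgfin := hle.trans_lt hfin
    rw [hEf', hEg g hg.1 hgfin, ENNReal.ofReal_le_ofReal_iff
      (integral_nonneg he₀nn)] at hle
    have hD := (hcal g hg.1 hgfin).2 hle
    have hDf := ae_weakDeriv_stretch l ha hm0 hm hM
    refine hf.eqOn_of_ae_weakDeriv_eq hg.1 hl ?_ ?_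
    · filter_upwards [hD, hDf] with z h1 h2
      rw [h1.1, h2.1]
    · filter_upwards [hD, hDf] with z h1 h2
      rw [h1.2, h2.2]

end Grotzsch

theorem mainTheorem3 (l L p : ℝ) (hl : 0 < l) (hL : 0 < L) (hp : 1 < p)
    (lam : ℝ → ℝ) (hlam : Grotzsch.PiecewiseContinuous l lam)
    (hbelow : ∃ c : ℝ, 0 < c ∧ ∀ x ∈ Set.Icc 0 l, c ≤ lam x)
    (habove : ∃ C : ℝ, ∀ x ∈ Set.Icc 0 l, lam x ≤ C) :
    ∃ f : ℂ → ℂ, Grotzsch.IsMinimiser l L p lam f ∧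
      Grotzsch.energy l p lam f < ⊤ ∧
      (∃ u : ℝ → ℝ, ∀ z ∈ Grotzsch.rect l, f z = (u z.re : ℂ) + (z.im : ℂ) * Complex.I) ∧
      ∀ g : ℂ → ℂ, Grotzsch.IsMinimiser l L p lam g → Set.EqOn g f (Grotzsch.rect l) :=
  Grotzsch.exists_unique_minimiser l L p hl hL hp lam hlam hbelow habove
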